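/- Let $S\subset\mathbb{R}^3$ be an oriented regular (smooth, embedded) surface with induced metric $g$, Levi-Civita connection $\nabla^g$ and Gauss map (unit normal field) $N:S\to S^2$. For a smooth tangent vector field $V$ on $S$, the \emph{metric connection with vectorial torsion} defined by $V$ is $$\nabla_XY=\nabla^g_XY+g(X,Y)V-g(V,Y)X .$$ Its geodesics are the smooth regular curves $\gamma$, defined on open intervals, with $\nabla_{\dot\gamma}\dot\gamma=0$, i.e. $\nabla^g_{\dot\gamma}\dot\gamma+g(\dot\gamma,\dot\gamma)V-g(V,\dot\gamma)\dot\gamma=0$. A \emph{geodesic mapping} between two surfaces with such connections is a diffeomorphism that maps geodesics to geodesics up to reparametrization. A \emph{surface of revolution} is a surface $S$ that is invariant under all rotations about the $z$-axis and does not meet this axis; $r=\sqrt{x^2+y^2}>0$ is the distance to the axis, $e_1$ and $e_2$ are the unit tangent fields along the meridians and the parallel circles, and a \emph{loxodrome} is a smooth regular curve, defined on an open interval, that makes a constant angle with the meridians. \begin{enumerate} \item Let $S$ be any surface of revolution and let $\nabla$ be the connection with vectorial torsion defined by $V=-\operatorname{grad}(-\ln r)$, which is a smooth tangent field. Then $\nabla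 e_1=\nabla e_2=0$, and $\nabla$ is flat. A curve on $S$ is a geodesic of $\nabla$ if and only if it is a loxodrome of constant speed, and a curve is a loxodrome if and only if it is a geodesic of $\nabla$ up to reparametrization. \item For $a>0$, let $C=\{x^2+y^2=a^2\cosh^2(z/a)\}$ be the catenoid, and let $S^2_*$ be the unit sphere without its two poles $(0,0,\pm1)$; both are surfaces of revolution, and we endow them with the flat connections of (1). The catenoid is a minimal surface, its Gauss map $N$ is a conformal map from $C$ to $S^2_*$, and $N$ maps loxodromes of $C$ to loxodromes of $S^2_*$. Moreover, $N:C\to S^2_*$ is a geodesic mapping for these connections. The Gaussian curvature of $S^2_*$ is constant, equal to $1$, whereas the Gaussian curvature of $C$ is not constant. \item Consequently, Beltrami's theorem does not hold for metric connections with vectorial torsion. That is, the following assertion is false: whenever $S,S'$ are connected oriented surfaces, endowed with metric connections with vectorial torsion defined by smooth tangent fields $V$ on $S$ and $V'$ on $S'$, such that there is a geodesic mapping from $S$ onto $S'$ and $S'$ has constant Gaussian curvature, then $S$ has constant Gaussian curvature. \end{enumerate} -/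

import Mathlib

open Set Filter Topology
open scoped ContDiff

namespace VectorialTorsion

noncomputable section

/-- Euclidean three-space. -/
abbrev E3 := EuclideanSpace ℝ (Fin 3)

/-- `f` is smooth on some open neighbourhood of the set `A`. -/
def SmoothNear {F : Type*} [NormedAddCommGroup F] [NormedSpace ℝ F]
    (A : Set E3) (f : E3 → F) : Prop :=
  ∃ O : Set E3, IsOpen O ∧ A ⊆ O ∧ ContDiffOn ℝ ∞ f O

/-- An oriented regular (smooth, embedded) surface in Euclidean three-space: a set that is locally
a regular level set `{F = 0}`, with a smooth unit normal field (its Gauss map). As usual, smooth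
objects on the surface are given by smooth extensions to a neighbourhood; all notions below depend
only on the restrictions to the surface. -/
structure OrientedSurface where
  /-- the underlying point set -/
  carrier : Set E3
  /-- the unit normal field; as a map into the unit sphere it is the Gauss map -/
  normal : E3 → E3
  normal_smooth : SmoothNear carrier normal
  normal_unit : ∀ p ∈ carrier, ‖normal p‖ = 1
  regular : ∀ p ∈ carrier, ∃ (W : Set E3) (F : E3 → ℝ) (c : ℝ),
    IsOpen W ∧ p ∈ W ∧ ContDiffOn ℝ ∞ F W ∧ (∀ q ∈ W, q ∈ carrier ↔ F q = 0) ∧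
      c ≠ 0 ∧ HasGradientAt F (c • normal p) p

namespace OrientedSurface

variable (S : OrientedSurface)

/-- The tangent plane at `p`, the orthogonal complement of the normal. -/
def tangentPlane (p : E3) : Submodule ℝ E3 := (Submodule.span ℝ {S.normal p})ᗮ

/-- The tangential part of an ambient vector `w` at `p`. -/
def tangentialPart (p w : E3) : E3 := w - inner ℝ (S.normal p) w • S.normal p

/-- Smooth tangent vector fields of the surface. -/
def IsTangentField (X : E3 → E3) : Prop :=
  SmoothNear S.carrier X ∧ ∀ p ∈ S.carrier, X p ∈ S.tangentPlane p

/-- The gradient, with respect to the induced metric, of (the restriction to `S` of) `f`. -/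
def grad (f : E3 → ℝ) (p : E3) : E3 := S.tangentialPart p (gradient f p)

/-- The Levi-Civita connection of the induced metric: `∇^g_v Y` at `p`, the tangential part of the
directional derivative. -/
def leviCivita (Y : E3 → E3) (p v : E3) : E3 := S.tangentialPart p (fderiv ℝ Y p v)

/-- The metric connection with vectorial torsion defined by the tangent field `V`:
`∇_v Y = ∇^g_v Y + g(v, Y) V - g(V, Y) v`. -/
def conn (V Y : E3 → E3) (p v : E3) : E3 :=
  S.leviCivita Y p v + inner ℝ v (Y p) • V p - inner ℝ (V p) (Y p) • v

/-- The field `∇_X Y`. -/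
def connField (V X Y : E3 → E3) : E3 → E3 := fun p => S.conn V Y p (X p)

/-- The curvature `R(X, Y) Z = ∇_X ∇_Y Z - ∇_Y ∇_X Z - ∇_[X,Y] Z` of the connection. -/
def curvature (V X Y Z : E3 → E3) (p : E3) : E3 :=
  S.connField V X (S.connField V Y Z) p - S.connField V Y (S.connField V X Z) p
    - S.conn V Z p (VectorField.lieBracket ℝ X Y p)

/-- The connection with vectorial torsion defined by `V` is flat. -/
def IsFlat (V : E3 → E3) : Prop :=
  ∀ X Y Z : E3 → E3, S.IsTangentField X → S.IsTangentField Y → S.IsTangentField Z →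
    ∀ p ∈ S.carrier, S.curvature V X Y Z p = 0

/-- The tangent field `Y` is parallel for the connection defined by `V`. -/
def IsParallel (V Y : E3 → E3) : Prop :=
  ∀ p ∈ S.carrier, ∀ v ∈ S.tangentPlane p, S.conn V Y p v = 0

/-- The shape operator (Weingarten map) `-dN` on the tangent plane at `p`. -/
def shapeOperator (p : E3) : S.tangentPlane p →ₗ[ℝ] S.tangentPlane p :=
  ((S.tangentPlane p).orthogonalProjectionOnto : E3 →ₗ[ℝ] S.tangentPlane p) ∘ₗ
    (-(fderiv ℝ S.normal p) : E3 →ₗ[ℝ] E3) ∘ₗ (S.tangentPlane p).subtype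

/-- The Gaussian curvature. -/
def gaussianCurvature (p : E3) : ℝ := LinearMap.det (S.shapeOperator p)

/-- The Gaussian curvature is constant. -/
def HasConstantCurvature : Prop := ∃ k : ℝ, ∀ p ∈ S.carrier, S.gaussianCurvature p = k

/-- Minimal surfaces: the mean curvature vanishes. -/
def IsMinimal : Prop := ∀ p ∈ S.carrier, LinearMap.trace ℝ _ (S.shapeOperator p) = 0

/-- `J` is a nonempty open interval and `γ` is a smooth regular curve on `S` defined on `J`. -/
def IsRegularCurve (J : Set ℝ) (γ : ℝ → E3) : Prop :=
  IsOpen J ∧ J.OrdConnected ∧ J.Nonempty ∧ ContDiffOn ℝ ∞ γ J ∧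
    ∀ t ∈ J, γ t ∈ S.carrier ∧ deriv γ t ≠ 0

/-- The (non-constant) geodesics of the connection with vectorial torsion defined by `V`:
`∇^g_γ' γ' + g(γ', γ') V - g(V, γ') γ' = 0`. -/
def IsGeodesic (V : E3 → E3) (J : Set ℝ) (γ : ℝ → E3) : Prop :=
  S.IsRegularCurve J γ ∧ ∀ t ∈ J,
    S.tangentialPart (γ t) (deriv (deriv γ) t) + inner ℝ (deriv γ t) (deriv γ t) • V (γ t)
      - inner ℝ (V (γ t)) (deriv γ t) • deriv γ t = 0

end OrientedSurface

/-- `τ` is a smooth change of parameter from the open interval `J'` onto the open interval `J`. -/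
def IsReparametrization (J' J : Set ℝ) (τ : ℝ → ℝ) : Prop :=
  IsOpen J' ∧ J'.OrdConnected ∧ IsOpen J ∧ J.OrdConnected ∧
    ContDiffOn ℝ ∞ τ J' ∧ BijOn τ J' J ∧ ∀ t ∈ J', deriv τ t ≠ 0

namespace OrientedSurface

variable (S : OrientedSurface)

/-- `γ` is a geodesic up to the choice of the parameter. -/
def IsGeodesicUpToParam (V : E3 → E3) (J : Set ℝ) (γ : ℝ → E3) : Prop :=
  ∃ (J' : Set ℝ) (τ : ℝ → ℝ), IsReparametrization J' J τ ∧ S.IsGeodesic V J' (γ ∘ τ)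

/-- `Φ` restricts to a diffeomorphism of `S` onto `S'`. -/
def IsDiffeo (S' : OrientedSurface) (Φ : E3 → E3) : Prop :=
  ∃ Ψ : E3 → E3, SmoothNear S.carrier Φ ∧ SmoothNear S'.carrier Ψ ∧
    MapsTo Φ S.carrier S'.carrier ∧ MapsTo Ψ S'.carrier S.carrier ∧
    InvOn Ψ Φ S.carrier S'.carrier

/-- `Φ` restricts to a conformal map from `S` to `S'`. -/
def IsConformalMap (S' : OrientedSurface) (Φ : E3 → E3) : Prop :=
  SmoothNear S.carrier Φ ∧ MapsTo Φ S.carrier S'.carrier ∧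
    ∀ p ∈ S.carrier, ∃ c : ℝ, 0 < c ∧ ∀ v ∈ S.tangentPlane p, ∀ w ∈ S.tangentPlane p,
      inner ℝ (fderiv ℝ Φ p v) (fderiv ℝ Φ p w) = c * inner ℝ v w

/-- `Φ` is a geodesic mapping of `S` onto `S'`, for the connections with vectorial torsion defined
by `V` on `S` and `V'` on `S'`: a diffeomorphism that maps geodesics to geodesics (up to the
choice of the parameter). -/
def IsGeodesicMapping (V : E3 → E3) (S' : OrientedSurface) (V' : E3 → E3) (Φ : E3 → E3) : Prop :=
  S.IsDiffeo S' Φ ∧ ∀ (J : Set ℝ) (γ : ℝ → E3),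
    S.IsGeodesic V J γ → S'.IsGeodesicUpToParam V' J (Φ ∘ γ)

end OrientedSurface

/-- The assertion of Beltrami's theorem, for metric connections with vectorial torsion in place of
Levi-Civita connections (which are the case `V = 0`, `V' = 0`). -/
def BeltramiAssertion : Prop :=
  ∀ (S S' : OrientedSurface) (V V' Φ : E3 → E3),
    IsConnected S.carrier → IsConnected S'.carrier →
    S.IsTangentField V → S'.IsTangentField V' →
    S.IsGeodesicMapping V S' V' Φ →
    S'.HasConstantCurvature → S.HasConstantCurvature

/-- Rotation by the angle `θ` about the third coordinate axis. -/
def rotation (θ : ℝ) (p : E3) : E3 :=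
  !₂[Real.cos θ * p 0 - Real.sin θ * p 1, Real.sin θ * p 0 + Real.cos θ * p 1, p 2]

/-- The distance `r` to the axis of rotation. -/
def axisDist (p : E3) : ℝ := Real.sqrt (p 0 ^ 2 + p 1 ^ 2)

/-- The unit tangent vector `e₂` of the parallel circle through `p`. -/
def parallelDir (p : E3) : E3 := (axisDist p)⁻¹ • !₂[-p 1, p 0, 0]

namespace OrientedSurface

variable (S : OrientedSurface)

/-- Surfaces of revolution about the third coordinate axis (not meeting the axis). -/
def IsSurfaceOfRevolution : Prop :=
  (∀ p ∈ S.carrier, 0 < axisDist p) ∧ ∀ p ∈ S.carrier, ∀ θ : ℝ, rotation θ p ∈ S.carrier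

/-- The unit tangent vector `e₁` of the meridian through `p`: the cross product of `e₂` with the
normal, so that it is tangent to `S` and orthogonal to the parallel circle. -/
def meridianDir (p : E3) : E3 :=
  WithLp.toLp 2 (crossProduct (WithLp.ofLp (parallelDir p)) (WithLp.ofLp (S.normal p)))

/-- The field `V = -grad (-log r) = grad (log r)`, that is `(r'/r) e₁` in the arc length parameter
of the meridians. -/
def revolutionField : E3 → E3 := S.grad (fun p => Real.log (axisDist p))

/-- Loxodromes of a surface of revolution: smooth regular curves which make a constant angle with
the meridians. -/
def IsLoxodrome (J : Set ℝ) (γ : ℝ → E3) : Prop :=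
  S.IsRegularCurve J γ ∧
    ∃ α : ℝ, ∀ t ∈ J, InnerProductGeometry.angle (deriv γ t) (S.meridianDir (γ t)) = α

end OrientedSurface

theorem hasGradientAt_of_coord {F : E3 → ℝ} {p : E3} {a b c : ℝ}
    (h : HasFDerivAt F (a • (EuclideanSpace.proj 0 : E3 →L[ℝ] ℝ)
      + b • (EuclideanSpace.proj 1 : E3 →L[ℝ] ℝ) + c • (EuclideanSpace.proj 2 : E3 →L[ℝ] ℝ)) p) :
    HasGradientAt F !₂[a, b, c] p := by
  rw [hasGradientAt_iff_hasFDerivAt]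
  refine h.congr_fderiv ?_
  ext v
  rw [InnerProductSpace.toDual_apply_apply]
  simp [PiLp.inner_apply, Fin.sum_univ_three]
  ring

theorem hasFDerivAt_coord (i : Fin 3) (p : E3) :
    HasFDerivAt (fun q : E3 => q i) (EuclideanSpace.proj i : E3 →L[ℝ] ℝ) p :=
  (EuclideanSpace.proj i : E3 →L[ℝ] ℝ).hasFDerivAt

theorem contDiff_coord (i : Fin 3) : ContDiff ℝ ∞ (fun q : E3 => q i) :=
  (EuclideanSpace.proj i : E3 →L[ℝ] ℝ).contDiff

/-- The unit sphere without its two poles, with the outer normal. -/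
def puncturedSphere : OrientedSurface where
  carrier := {p | p 0 ^ 2 + p 1 ^ 2 + p 2 ^ 2 = 1 ∧ 0 < axisDist p}
  normal := fun p => p
  normal_smooth := ⟨univ, isOpen_univ, subset_univ _, contDiff_id.contDiffOn⟩
  normal_unit := by
    rintro p ⟨hp, -⟩
    rw [EuclideanSpace.norm_eq]
    simp [Fin.sum_univ_three, hp]
  regular := by
    rintro p ⟨-, hp⟩
    have hc := fun i => contDiff_coord i
    refine ⟨{q | 0 < axisDist q}, fun q => q 0 ^ 2 + q 1 ^ 2 + q 2 ^ 2 - 1, 2, ?_, hp, ?_, ?_,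
      two_ne_zero, ?_⟩
    · refine isOpen_lt continuous_const ?_
      have := fun i => (contDiff_coord i).continuous
      unfold axisDist
      fun_prop
    · exact (((((hc 0).pow 2).add ((hc 1).pow 2)).add ((hc 2).pow 2)).sub
        contDiff_const).contDiffOn
    · intro q hq
      have hq' : 0 < axisDist q := hq
      simp only [mem_ofPred_eq, hq', and_true, sub_eq_zero]
    · have h := hasGradientAt_of_coord (F := fun q : E3 => q 0 ^ 2 + q 1 ^ 2 + q 2 ^ 2 - 1)
        (p := p) (a := 2 * p 0) (b := 2 * p 1) (c := 2 * p 2) (by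
          have := (((((hasFDerivAt_coord 0 p).pow 2).add ((hasFDerivAt_coord 1 p).pow 2)).add
            ((hasFDerivAt_coord 2 p).pow 2)).sub_const 1)
          refine this.congr_fderiv ?_
          ext v
          simp)
      convert h using 1
      ext i
      fin_cases i <;> simp

/-- The catenoid `x² + y² = a² cosh² (z / a)`, `a > 0`. -/
def catenoid (a : ℝ) (ha : 0 < a) : OrientedSurface where
  carrier := {p | p 0 ^ 2 + p 1 ^ 2 = a ^ 2 * Real.cosh (p 2 / a) ^ 2}
  normal := fun p => !₂[-p 0 / (a * Real.cosh (p 2 / a) ^ 2),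
    -p 1 / (a * Real.cosh (p 2 / a) ^ 2), Real.sinh (p 2 / a) / Real.cosh (p 2 / a)]
  normal_smooth := by
    refine ⟨univ, isOpen_univ, subset_univ _, ContDiff.contDiffOn ?_⟩
    have hc := fun i => contDiff_coord i
    have hpos : ∀ q : E3, Real.cosh (q 2 / a) ≠ 0 := fun q => (Real.cosh_pos _).ne'
    have hz : ContDiff ℝ ∞ (fun q : E3 => q 2 / a) := (hc 2).div_const a
    have hne : ∀ q : E3, a * Real.cosh (q 2 / a) ^ 2 ≠ 0 :=
      fun q => mul_ne_zero ha.ne' (pow_ne_zero _ (hpos q))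
    rw [contDiff_euclidean]
    intro i
    fin_cases i
    · exact (hc 0).neg.div (contDiff_const.mul (hz.cosh.pow 2)) hne
    · exact (hc 1).neg.div (contDiff_const.mul (hz.cosh.pow 2)) hne
    · exact hz.sinh.div hz.cosh hpos
  normal_unit := by
    intro p hp
    have hp' : p 0 ^ 2 + p 1 ^ 2 = a ^ 2 * Real.cosh (p 2 / a) ^ 2 := hp
    have hC : Real.cosh (p 2 / a) ≠ 0 := (Real.cosh_pos _).ne'
    have ha' := ha.ne'
    rw [EuclideanSpace.norm_eq, Real.sqrt_eq_one]
    simp only [Fin.sum_univ_three, Real.norm_eq_abs, sq_abs]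
    have h1 := Real.cosh_sq (p 2 / a)
    simp only [Matrix.cons_val_zero, Matrix.cons_val_one, Matrix.cons_val]
    field_simp
    linear_combination hp' - a ^ 2 * Real.cosh (p 2 / a) ^ 2 * h1
  regular := by
    intro p hp
    have hc := fun i => contDiff_coord i
    have hC : Real.cosh (p 2 / a) ≠ 0 := (Real.cosh_pos _).ne'
    have ha' := ha.ne'
    refine ⟨univ, fun q => q 0 ^ 2 + q 1 ^ 2 - a ^ 2 * Real.cosh (q 2 / a) ^ 2,
      -2 * a * Real.cosh (p 2 / a) ^ 2, isOpen_univ, mem_univ _, ?_, ?_, ?_, ?_⟩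
    · exact ((((hc 0).pow 2).add ((hc 1).pow 2)).sub
        (contDiff_const.mul (((hc 2).div_const a).cosh.pow 2))).contDiffOn
    · intro q _
      simp only [mem_ofPred_eq, sub_eq_zero]
    · simp [ha', hC]
    · have h := hasGradientAt_of_coord
        (F := fun q : E3 => q 0 ^ 2 + q 1 ^ 2 - a ^ 2 * Real.cosh (q 2 / a) ^ 2)
        (p := p) (a := 2 * p 0) (b := 2 * p 1)
        (c := -2 * a * Real.cosh (p 2 / a) * Real.sinh (p 2 / a)) (by
          have hz : HasFDerivAt (fun q : E3 => q 2 / a)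
              (a⁻¹ • (EuclideanSpace.proj 2 : E3 →L[ℝ] ℝ)) p := by
            simpa [div_eq_inv_mul] using (hasFDerivAt_coord 2 p).const_mul a⁻¹
          have := ((((hasFDerivAt_coord 0 p).pow 2).add ((hasFDerivAt_coord 1 p).pow 2)).sub
            ((hz.cosh.pow 2).const_mul (a ^ 2)))
          refine this.congr_fderiv ?_
          ext v
          simp
          field_simp
          ring)
      convert h using 1
      ext i
      fin_cases i
      · simp; field_simp
      · simp; field_simp
      · simp; field_simp

end

end VectorialTorsion

open VectorialTorsion

open Set Filter Topology
open scoped ContDiff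

namespace VectorialTorsion

noncomputable section

/-! On a surface of revolution the ambient derivative of `e₂` in direction `v` is `-⟨v, e₂⟩` times
the ambient gradient of `log r`. Its tangential part is `-g(v, e₂) V`, which the torsion term `g(v,
e₂) V` cancels; the remaining term vanishes because `V ⟂ e₂`. So `e₂` is parallel
(`isParallel_parallelDir`), and since the connection is metric, so is the other field `e₁` of the
orthonormal frame (`IsFrame.isParallel_fst`).

In a parallel frame the connection merely differentiates components. Hence it is flat
(`IsFrame.isFlat`), and a curve is a geodesic exactly when both frame components of its velocity are
constant (`IsFrame.isGeodesic_iff`). For regular curves this means constant speed and constant angle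
with `e₁`; reparametrization by arc length then handles arbitrary loxodromes.

On the catenoid `e₁` and `e₂` are principal: `dN e₁ = k e₁` and `dN e₂ = -k e₂` with `k = 1 / (a
cosh² (z/a))`. This yields minimality, Gaussian curvature `-k²`, which is not constant, and
conformality with factor `k²`. The frame of the sphere at `N p` is `-e₁, -e₂`, so `N` turns a
constant angle `α` into `π - α` and preserves loxodromes. With the explicit inverse of `N` this
gives a geodesic mapping onto a surface of curvature `1`, which refutes Beltrami's assertion.

Smooth objects on `S` are ambient extensions, so a basic tool is that tangential derivatives see
only the restriction to `S` (`fderiv_eq_zero_of_forall_mem_eq_zero`). -/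

theorem inner_eq_coord (v w : E3) : inner ℝ v w = v 0 * w 0 + v 1 * w 1 + v 2 * w 2 := by
  simp [PiLp.inner_apply, Fin.sum_univ_three]
  ring

/-! ### Smooth maps near a set -/

namespace SmoothNear

variable {F : Type*} [NormedAddCommGroup F] [NormedSpace ℝ F] {A : Set E3}

theorem contDiffAt {f : E3 → F} (hf : SmoothNear A f) {p : E3} (hp : p ∈ A) :
    ContDiffAt ℝ ∞ f p := by
  obtain ⟨O, hO, hAO, h⟩ := hf
  exact h.contDiffAt (hO.mem_nhds (hAO hp))

theorem differentiableAt {f : E3 → F} (hf : SmoothNear A f) {p : E3} (hp : p ∈ A) :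
    DifferentiableAt ℝ f p :=
  (hf.contDiffAt hp).differentiableAt (by simp)

theorem add {f g : E3 → F} (hf : SmoothNear A f) (hg : SmoothNear A g) :
    SmoothNear A (fun q => f q + g q) := by
  obtain ⟨O, hO, hAO, h⟩ := hf
  obtain ⟨O', hO', hAO', h'⟩ := hg
  exact ⟨O ∩ O', hO.inter hO', subset_inter hAO hAO',
    (h.mono inter_subset_left).add (h'.mono inter_subset_right)⟩

theorem sub {f g : E3 → F} (hf : SmoothNear A f) (hg : SmoothNear A g) :
    SmoothNear A (fun q => f q - g q) := by
  obtain ⟨O, hO, hAO, h⟩ := hf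
  obtain ⟨O', hO', hAO', h'⟩ := hg
  exact ⟨O ∩ O', hO.inter hO', subset_inter hAO hAO',
    (h.mono inter_subset_left).sub (h'.mono inter_subset_right)⟩

theorem smul {f : E3 → ℝ} {g : E3 → F} (hf : SmoothNear A f) (hg : SmoothNear A g) :
    SmoothNear A (fun q => f q • g q) := by
  obtain ⟨O, hO, hAO, h⟩ := hf
  obtain ⟨O', hO', hAO', h'⟩ := hg
  exact ⟨O ∩ O', hO.inter hO', subset_inter hAO hAO',
    (h.mono inter_subset_left).smul (h'.mono inter_subset_right)⟩

theorem inner {f g : E3 → E3} (hf : SmoothNear A f) (hg : SmoothNear A g) :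
    SmoothNear A (fun q => inner ℝ (f q) (g q)) := by
  obtain ⟨O, hO, hAO, h⟩ := hf
  obtain ⟨O', hO', hAO', h'⟩ := hg
  exact ⟨O ∩ O', hO.inter hO', subset_inter hAO hAO',
    (h.mono inter_subset_left).inner ℝ (h'.mono inter_subset_right)⟩

theorem fderiv_apply {f : E3 → F} {X : E3 → E3} (hf : SmoothNear A f) (hX : SmoothNear A X) :
    SmoothNear A (fun q => fderiv ℝ f q (X q)) := by
  obtain ⟨O, hO, hAO, h⟩ := hf
  obtain ⟨O', hO', hAO', h'⟩ := hX
  refine ⟨O ∩ O', hO.inter hO', subset_inter hAO hAO', ?_⟩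
  exact ((h.fderiv_of_isOpen hO le_rfl).mono inter_subset_left).clm_apply
    (h'.mono inter_subset_right)

end SmoothNear

theorem fderiv_inner_apply' {f g : E3 → E3} {p : E3} (hf : DifferentiableAt ℝ f p)
    (hg : DifferentiableAt ℝ g p) (v : E3) :
    fderiv ℝ (fun q => inner ℝ (f q) (g q)) p v =
      inner ℝ (f p) (fderiv ℝ g p v) + inner ℝ (fderiv ℝ f p v) (g p) :=
  fderiv_inner_apply ℝ hf hg v

/-- The Lie bracket as a commutator of derivations. -/
theorem fderiv_fderiv_sub_fderiv_fderiv {F : Type*} [NormedAddCommGroup F] [NormedSpace ℝ F]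
    {f : E3 → F} {X Y : E3 → E3} {p : E3}
    (hf : ContDiffAt ℝ ∞ f p) (hX : DifferentiableAt ℝ X p) (hY : DifferentiableAt ℝ Y p) :
    fderiv ℝ (fun q => fderiv ℝ f q (Y q)) p (X p)
      - fderiv ℝ (fun q => fderiv ℝ f q (X q)) p (Y p)
      = fderiv ℝ f p (VectorField.lieBracket ℝ X Y p) := by
  have h1 : DifferentiableAt ℝ (fderiv ℝ f) p :=
    (hf.fderiv_right (m := 1) (by norm_cast)).differentiableAt (by simp)
  have hs : IsSymmSndFDerivAt ℝ f p := hf.isSymmSndFDerivAt (by simp; norm_cast)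
  rw [fderiv_clm_apply h1 hY, fderiv_clm_apply h1 hX]
  simp only [VectorField.lieBracket_eq, add_apply,
    ContinuousLinearMap.comp_apply, ContinuousLinearMap.flip_apply, map_sub, hs.eq (X p) (Y p)]
  abel

/-- Expansion of a vector in an orthonormal frame. -/
theorem orthonormal_frame_expansion {a b c : E3} (ha : ‖a‖ = 1) (hb : ‖b‖ = 1) (hc : ‖c‖ = 1)
    (hab : inner ℝ a b = 0) (hac : inner ℝ a c = 0) (hbc : inner ℝ b c = 0) (v : E3) :
    inner ℝ a v • a + inner ℝ b v • b + inner ℝ c v • c = v := by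
  have ho : Orthonormal ℝ ![a, b, c] := by
    have hba : inner ℝ b a = 0 := by rw [real_inner_comm, hab]
    have hca : inner ℝ c a = 0 := by rw [real_inner_comm, hac]
    have hcb : inner ℝ c b = 0 := by rw [real_inner_comm, hbc]
    constructor
    · intro i; fin_cases i <;> simpa
    · intro i j hij; fin_cases i <;> fin_cases j <;> simp_all
  have hcard : Fintype.card (Fin 3) = Module.finrank ℝ E3 := by simp
  let B := (basisOfOrthonormalOfCardEqFinrank ho hcard).toOrthonormalBasis (by simpa using ho)
  have := B.sum_repr' v
  simpa [B, Fin.sum_univ_three] using this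

/-! ### Tangential calculus on a surface. -/

namespace OrientedSurface

variable {S : OrientedSurface}

theorem mem_tangentPlane {p v : E3} : v ∈ S.tangentPlane p ↔ inner ℝ (S.normal p) v = 0 :=
  Submodule.mem_orthogonal_singleton_iff_inner_right

theorem inner_normal_self {p : E3} (hp : p ∈ S.carrier) :
    inner ℝ (S.normal p) (S.normal p) = 1 := by
  rw [real_inner_self_eq_norm_sq, S.normal_unit p hp, one_pow]

theorem tangentialPart_mem {p : E3} (hp : p ∈ S.carrier) (w : E3) :
    S.tangentialPart p w ∈ S.tangentPlane p := by
  rw [mem_tangentPlane, tangentialPart, inner_sub_right, inner_smul_right, inner_normal_self hp]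
  ring

theorem inner_tangentialPart {p v : E3} (hv : v ∈ S.tangentPlane p) (w : E3) :
    inner ℝ (S.tangentialPart p w) v = inner ℝ w v := by
  rw [tangentialPart, inner_sub_left, inner_smul_left, mem_tangentPlane.1 hv]
  simp

theorem tangentialPart_eq_self {p v : E3} (hv : v ∈ S.tangentPlane p) :
    S.tangentialPart p v = v := by
  rw [tangentialPart, mem_tangentPlane.1 hv, zero_smul, sub_zero]

theorem tangentialPart_add (p v w : E3) :
    S.tangentialPart p (v + w) = S.tangentialPart p v + S.tangentialPart p w := by
  simp only [tangentialPart, inner_add_right, add_smul]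
  abel

theorem tangentialPart_smul (p w : E3) (c : ℝ) :
    S.tangentialPart p (c • w) = c • S.tangentialPart p w := by
  simp only [tangentialPart, inner_smul_right, smul_sub, mul_smul]

/-- A function that vanishes on the surface has vanishing tangential derivatives. -/
theorem fderiv_eq_zero_of_forall_mem_eq_zero {f : E3 → ℝ} {p v : E3} (hp : p ∈ S.carrier)
    (hf : ContDiffAt ℝ ∞ f p) (h : ∀ᶠ q in 𝓝 p, q ∈ S.carrier → f q = 0)
    (hv : v ∈ S.tangentPlane p) : fderiv ℝ f p v = 0 := by
  obtain ⟨W, F, c, hW, hpW, hF, hiff, hc, hgrad⟩ := S.regular p hp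
  have hFp : F p = 0 := (hiff p hpW).1 hp
  -- Being constant on the level set of `F`, `f` has a constrained extremum at `p`, so Lagrange
  -- multipliers give `a dF + b df = 0`.
  have hext : IsLocalExtrOn f {x | F x = F p} p := by
    left
    have h2 : ∀ᶠ q in 𝓝[{x | F x = F p}] p, f p ≤ f q := by
      filter_upwards [nhdsWithin_le_nhds h, nhdsWithin_le_nhds (hW.mem_nhds hpW),
        self_mem_nhdsWithin] with q hq hqW hqF
      have hqF' : F q = F p := hqF
      rw [hq ((hiff q hqW).2 (hqF'.trans hFp)), h.self_of_nhds hp]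
    exact h2
  have hsF := (hF.contDiffAt (hW.mem_nhds hpW)).hasStrictFDerivAt (by simp)
  have hsf := hf.hasStrictFDerivAt (by simp)
  obtain ⟨a, b, hab, h0⟩ := hext.exists_multipliers_of_hasStrictFDerivAt_1d hsF hsf
  have hFd : ∀ w, fderiv ℝ F p w = c * inner ℝ (S.normal p) w := by
    intro w
    rw [hgrad.hasFDerivAt.fderiv, InnerProductSpace.toDual_apply_apply, inner_smul_left]
    simp
  -- If `b` vanished, evaluating at the normal, where `dF` equals `c ≠ 0`, would force `a = 0` as
  -- well.
  have hb : b ≠ 0 := by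
    rintro rfl
    have := DFunLike.congr_fun h0 (S.normal p)
    simp only [zero_smul, add_zero, smul_apply, hFd, inner_normal_self hp, zero_apply,
      smul_eq_mul, mul_one, mul_eq_zero, hc, or_false] at this
    exact hab (by simp [this])
  have := DFunLike.congr_fun h0 v
  simpa [hFd, mem_tangentPlane.1 hv, hb] using this

/-- The tangential derivative depends only on the restriction to the surface. -/
theorem fderiv_eq_of_eqOn {f g : E3 → E3} {p v : E3} (hp : p ∈ S.carrier)
    (hf : ContDiffAt ℝ ∞ f p) (hg : ContDiffAt ℝ ∞ g p) (h : EqOn f g S.carrier)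
    (hv : v ∈ S.tangentPlane p) : fderiv ℝ f p v = fderiv ℝ g p v := by
  refine ext_inner_left ℝ fun w => ?_
  have hfd := hf.differentiableAt (by simp)
  have hgd := hg.differentiableAt (by simp)
  have key := fderiv_eq_zero_of_forall_mem_eq_zero (f := fun q => inner ℝ w (f q - g q)) hp
    (contDiffAt_const.inner ℝ (hf.sub hg))
    (Eventually.of_forall fun q hq => by rw [h hq, sub_self, inner_zero_right]) hv
  rw [fderiv_inner_apply' (differentiableAt_const w) (hfd.fun_sub hgd), fderiv_fun_sub hfd hgd] at key
  simp [inner_sub_right] at key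
  linarith

/-- Velocities of curves on the surface are tangent. -/
theorem hasDerivAt_mem_tangentPlane {c : ℝ → E3} {c' : E3} {t : ℝ} (hc : HasDerivAt c c' t)
    (h : ∀ᶠ s in 𝓝 t, c s ∈ S.carrier) : c' ∈ S.tangentPlane (c t) := by
  obtain ⟨W, F, k, hW, hpW, -, hiff, hk, hgrad⟩ := S.regular _ h.self_of_nhds
  have h1 := hgrad.hasFDerivAt.comp_hasDerivAt t hc
  have h2 : F ∘ c =ᶠ[𝓝 t] fun _ => 0 := by
    filter_upwards [h, hc.continuousAt.preimage_mem_nhds (hW.mem_nhds hpW)] with s hs hsW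
    exact (hiff _ hsW).1 hs
  have h3 := h1.unique ((hasDerivAt_const t (0 : ℝ)).congr_of_eventuallyEq h2)
  rw [InnerProductSpace.toDual_apply_apply, inner_smul_left] at h3
  rw [mem_tangentPlane]
  simpa [hk] using h3

/-! ### The connection -/

/-- A field and its frame expansion agree on the surface only, not as ambient maps; this allows one
to replace the other under the connection. -/
theorem conn_congr {V Y Y' : E3 → E3} {p v : E3} (hp : p ∈ S.carrier)
    (hY : ContDiffAt ℝ ∞ Y p) (hY' : ContDiffAt ℝ ∞ Y' p) (h : EqOn Y Y' S.carrier)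
    (hv : v ∈ S.tangentPlane p) : S.conn V Y p v = S.conn V Y' p v := by
  simp only [conn, leviCivita, h hp, fderiv_eq_of_eqOn hp hY hY' h hv]

theorem conn_add {V Y Z : E3 → E3} {p : E3} (v : E3) (hY : DifferentiableAt ℝ Y p)
    (hZ : DifferentiableAt ℝ Z p) :
    S.conn V (fun q => Y q + Z q) p v = S.conn V Y p v + S.conn V Z p v := by
  simp only [conn, leviCivita, fderiv_fun_add hY hZ, add_apply,
    tangentialPart_add, inner_add_right, add_smul]
  abel

theorem conn_smul {V Y : E3 → E3} {f : E3 → ℝ} {p : E3} (v : E3) (hf : DifferentiableAt ℝ f p)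
    (hY : DifferentiableAt ℝ Y p) (hYp : Y p ∈ S.tangentPlane p) :
    S.conn V (fun q => f q • Y q) p v = fderiv ℝ f p v • Y p + f p • S.conn V Y p v := by
  simp only [conn, leviCivita, fderiv_fun_smul hf hY, add_apply,
    smul_apply, ContinuousLinearMap.smulRight_apply,
    tangentialPart_add, tangentialPart_smul, tangentialPart_eq_self hYp, inner_smul_right]
  module

theorem conn_mem {V : E3 → E3} {p v : E3} (hp : p ∈ S.carrier) (hV : V p ∈ S.tangentPlane p)
    (hv : v ∈ S.tangentPlane p) (Y : E3 → E3) : S.conn V Y p v ∈ S.tangentPlane p :=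
  sub_mem (add_mem (tangentialPart_mem hp _) (Submodule.smul_mem _ _ hV))
    (Submodule.smul_mem _ _ hv)

theorem smoothNear_tangentialPart {f : E3 → E3} (hf : SmoothNear S.carrier f) :
    SmoothNear S.carrier (fun q => S.tangentialPart q (f q)) :=
  hf.sub ((S.normal_smooth.inner hf).smul S.normal_smooth)

theorem smoothNear_connField {V X Y : E3 → E3} (hV : SmoothNear S.carrier V)
    (hX : SmoothNear S.carrier X) (hY : SmoothNear S.carrier Y) :
    SmoothNear S.carrier (S.connField V X Y) :=
  ((smoothNear_tangentialPart (hY.fderiv_apply hX)).add ((hX.inner hY).smul hV)).sub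
    ((hV.inner hY).smul hX)

/-- The connection is metric. -/
theorem fderiv_inner_eq_conn {V Y Z : E3 → E3} {p v : E3}
    (hY : DifferentiableAt ℝ Y p) (hZ : DifferentiableAt ℝ Z p)
    (hYp : Y p ∈ S.tangentPlane p) (hZp : Z p ∈ S.tangentPlane p) :
    fderiv ℝ (fun q => inner ℝ (Y q) (Z q)) p v =
      inner ℝ (S.conn V Y p v) (Z p) + inner ℝ (S.conn V Z p v) (Y p) := by
  rw [fderiv_inner_apply' hY hZ]
  simp only [conn, leviCivita, inner_sub_left, inner_add_left, inner_tangentialPart hYp,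
    inner_tangentialPart hZp, inner_smul_left]
  rw [real_inner_comm (fderiv ℝ Z p v) (Y p)]
  simp
  ring

/-- Apply the commutator identity to a local defining function `F`. Both `dF(X)` and `dF(Y)` vanish
on the surface near `p`, so their tangential derivatives vanish at `p`, leaving `dF([X, Y]) = 0`. -/
theorem lieBracket_mem {X Y : E3 → E3} (hX : S.IsTangentField X) (hY : S.IsTangentField Y)
    {p : E3} (hp : p ∈ S.carrier) : VectorField.lieBracket ℝ X Y p ∈ S.tangentPlane p := by
  obtain ⟨W, F, c, hW, hpW, hF, hiff, hc, hgrad⟩ := S.regular p hp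
  have hFp := hF.contDiffAt (hW.mem_nhds hpW)
  have hz : ∀ Z : E3 → E3, S.IsTangentField Z → ∀ᶠ q in 𝓝 p, q ∈ S.carrier →
      fderiv ℝ F q (Z q) = 0 := by
    intro Z hZ
    filter_upwards [hW.mem_nhds hpW] with q hqW hq
    refine fderiv_eq_zero_of_forall_mem_eq_zero hq (hF.contDiffAt (hW.mem_nhds hqW)) ?_ (hZ.2 q hq)
    filter_upwards [hW.mem_nhds hqW] with x hx hxS
    exact (hiff x hx).1 hxS
  have hd : ∀ Z : E3 → E3, S.IsTangentField Z →
      ContDiffAt ℝ ∞ (fun q => fderiv ℝ F q (Z q)) p := fun Z hZ =>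
    (hFp.fderiv_right (m := ∞) (by simp)).clm_apply (hZ.1.contDiffAt hp)
  have key := fderiv_fderiv_sub_fderiv_fderiv hFp (hX.1.differentiableAt hp)
    (hY.1.differentiableAt hp)
  rw [fderiv_eq_zero_of_forall_mem_eq_zero hp (hd Y hY) (hz Y hY) (hX.2 p hp),
    fderiv_eq_zero_of_forall_mem_eq_zero hp (hd X hX) (hz X hX) (hY.2 p hp),
    hgrad.hasFDerivAt.fderiv, InnerProductSpace.toDual_apply_apply, inner_smul_left] at key
  rw [mem_tangentPlane]
  simpa [hc] using key.symm

/-- `e₁, e₂` is an orthonormal frame of tangent fields. -/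
structure IsFrame (S : OrientedSurface) (e₁ e₂ : E3 → E3) : Prop where
  tangent_fst : S.IsTangentField e₁
  tangent_snd : S.IsTangentField e₂
  norm_fst : ∀ p ∈ S.carrier, ‖e₁ p‖ = 1
  norm_snd : ∀ p ∈ S.carrier, ‖e₂ p‖ = 1
  inner_eq_zero : ∀ p ∈ S.carrier, inner ℝ (e₁ p) (e₂ p) = 0

namespace IsFrame

variable {e₁ e₂ V : E3 → E3} (h : S.IsFrame e₁ e₂)
include h

theorem expansion {p v : E3} (hp : p ∈ S.carrier) (hv : v ∈ S.tangentPlane p) :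
    inner ℝ (e₁ p) v • e₁ p + inner ℝ (e₂ p) v • e₂ p = v := by
  have := orthonormal_frame_expansion (h.norm_fst p hp) (h.norm_snd p hp) (S.normal_unit p hp)
    (h.inner_eq_zero p hp)
    (by rw [real_inner_comm]; exact mem_tangentPlane.1 (h.tangent_fst.2 p hp))
    (by rw [real_inner_comm]; exact mem_tangentPlane.1 (h.tangent_snd.2 p hp)) v
  rwa [mem_tangentPlane.1 hv, zero_smul, add_zero] at this

theorem eq_zero {p v : E3} (hp : p ∈ S.carrier) (hv : v ∈ S.tangentPlane p)
    (h1 : inner ℝ (e₁ p) v = 0) (h2 : inner ℝ (e₂ p) v = 0) : v = 0 := by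
  rw [← h.expansion hp hv, h1, h2]
  simp

theorem inner_eq {p v w : E3} (hp : p ∈ S.carrier) (hv : v ∈ S.tangentPlane p) :
    inner ℝ v w = inner ℝ (e₁ p) v * inner ℝ (e₁ p) w + inner ℝ (e₂ p) v * inner ℝ (e₂ p) w := by
  conv_lhs => rw [← h.expansion hp hv]
  simp [inner_add_left, inner_smul_left]

/-- If one of the fields of a frame is parallel, then so is the other. -/
theorem isParallel_fst (hV : S.IsTangentField V) (h2 : S.IsParallel V e₂) :
    S.IsParallel V e₁ := by
  intro p hp v hv
  have hd1 := h.tangent_fst.1.differentiableAt hp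
  have hd2 := h.tangent_snd.1.differentiableAt hp
  have ht1 := h.tangent_fst.2 p hp
  have ht2 := h.tangent_snd.2 p hp
  refine h.eq_zero hp (conn_mem hp (hV.2 p hp) hv _) ?_ ?_
  -- Differentiating `|e₁|² = 1` kills the `e₁`-component; differentiating `⟨e₁, e₂⟩ = 0`, with `e₂`
  -- parallel, kills the other.
  · have h0 := fderiv_eq_zero_of_forall_mem_eq_zero (f := fun q => inner ℝ (e₁ q) (e₁ q) - 1) hp
      (((h.tangent_fst.1.inner h.tangent_fst.1).contDiffAt hp).sub contDiffAt_const)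
      (Eventually.of_forall fun q hq => by
        rw [real_inner_self_eq_norm_sq, h.norm_fst q hq]; norm_num) hv
    rw [fderiv_sub_const, fderiv_inner_eq_conn (S := S) (V := V) hd1 hd1 ht1 ht1] at h0
    rw [real_inner_comm]
    linarith
  · have h0 := fderiv_eq_zero_of_forall_mem_eq_zero (f := fun q => inner ℝ (e₁ q) (e₂ q)) hp
      ((h.tangent_fst.1.inner h.tangent_snd.1).contDiffAt hp)
      (Eventually.of_forall fun q hq => h.inner_eq_zero q hq) hv
    rw [fderiv_inner_eq_conn (S := S) (V := V) hd1 hd2 ht1 ht2, h2 p hp v hv] at h0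
    rw [real_inner_comm]
    simpa using h0

theorem conn_smul_add_smul (h1 : S.IsParallel V e₁) (h2 : S.IsParallel V e₂)
    {f g : E3 → ℝ} {p v : E3} (hp : p ∈ S.carrier) (hv : v ∈ S.tangentPlane p)
    (hf : DifferentiableAt ℝ f p) (hg : DifferentiableAt ℝ g p) :
    S.conn V (fun q => f q • e₁ q + g q • e₂ q) p v =
      fderiv ℝ f p v • e₁ p + fderiv ℝ g p v • e₂ p := by
  have hd1 := h.tangent_fst.1.differentiableAt hp
  have hd2 := h.tangent_snd.1.differentiableAt hp
  rw [conn_add v (hf.fun_smul hd1) (hg.fun_smul hd2), conn_smul v hf hd1 (h.tangent_fst.2 p hp),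
    conn_smul v hg hd2 (h.tangent_snd.2 p hp), h1 p hp v hv, h2 p hp v hv]
  simp

/-- In a parallel frame, the connection differentiates the components. -/
theorem conn_eq (h1 : S.IsParallel V e₁) (h2 : S.IsParallel V e₂) {Z : E3 → E3}
    (hZ : S.IsTangentField Z) {p v : E3} (hp : p ∈ S.carrier) (hv : v ∈ S.tangentPlane p) :
    S.conn V Z p v = fderiv ℝ (fun q => inner ℝ (e₁ q) (Z q)) p v • e₁ p
      + fderiv ℝ (fun q => inner ℝ (e₂ q) (Z q)) p v • e₂ p := by
  have hs1 := h.tangent_fst.1.inner hZ.1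
  have hs2 := h.tangent_snd.1.inner hZ.1
  rw [← h.conn_smul_add_smul h1 h2 hp hv (hs1.differentiableAt hp) (hs2.differentiableAt hp)]
  exact conn_congr hp (hZ.1.contDiffAt hp)
    (((hs1.smul h.tangent_fst.1).add (hs2.smul h.tangent_snd.1)).contDiffAt hp)
    (fun q hq => (h.expansion hq (hZ.2 q hq)).symm) hv

/-- A connection with a parallel frame is flat. -/
theorem isFlat (hV : S.IsTangentField V) (h1 : S.IsParallel V e₁) (h2 : S.IsParallel V e₂) :
    S.IsFlat V := by
  intro X Y Z hX hY hZ p hp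
  have hs1 := h.tangent_fst.1.inner hZ.1
  have hs2 := h.tangent_snd.1.inner hZ.1
  -- With `f` a component of `Z`, the corresponding component of the curvature is `X(Y f) - Y(X f) -
  -- [X, Y] f`, which is zero.
  have key : ∀ X Y : E3 → E3, S.IsTangentField X → S.IsTangentField Y →
      S.connField V X (S.connField V Y Z) p =
      fderiv ℝ (fun q => fderiv ℝ (fun q => inner ℝ (e₁ q) (Z q)) q (Y q)) p (X p) • e₁ p +
      fderiv ℝ (fun q => fderiv ℝ (fun q => inner ℝ (e₂ q) (Z q)) q (Y q)) p (X p) • e₂ p := by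
    intro X Y hX hY
    have hd1 := hs1.fderiv_apply hY.1
    have hd2 := hs2.fderiv_apply hY.1
    rw [connField, ← h.conn_smul_add_smul h1 h2 hp (hX.2 p hp) (hd1.differentiableAt hp)
      (hd2.differentiableAt hp)]
    exact conn_congr hp ((smoothNear_connField hV.1 hY.1 hZ.1).contDiffAt hp)
      (((hd1.smul h.tangent_fst.1).add (hd2.smul h.tangent_snd.1)).contDiffAt hp)
      (fun q hq => h.conn_eq h1 h2 hZ hq (hY.2 q hq)) (hX.2 p hp)
  have b1 := fderiv_fderiv_sub_fderiv_fderiv (hs1.contDiffAt hp) (hX.1.differentiableAt hp)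
    (hY.1.differentiableAt hp)
  have b2 := fderiv_fderiv_sub_fderiv_fderiv (hs2.contDiffAt hp) (hX.1.differentiableAt hp)
    (hY.1.differentiableAt hp)
  rw [curvature, key X Y hX hY, key Y X hY hX, h.conn_eq h1 h2 hZ hp (lieBracket_mem hX hY hp),
    ← b1, ← b2]
  module

end IsFrame

end OrientedSurface

/-! ### Changes of parameter -/

namespace IsReparametrization

variable {J J' : Set ℝ} {τ : ℝ → ℝ}

/-- Smooth functions with positive derivative are changes of parameter onto their image. -/
theorem of_deriv_pos (hJ : IsOpen J) (hJc : J.OrdConnected) (hτ : ContDiffOn ℝ ∞ τ J)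
    (hpos : ∀ t ∈ J, 0 < deriv τ t) : IsReparametrization J (τ '' J) τ := by
  have hmono : StrictMonoOn τ J := by
    refine strictMonoOn_of_deriv_pos hJc.convex hτ.continuousOn fun t ht => hpos t ?_
    exact interior_subset ht
  refine ⟨hJ, hJc, isOpen_iff_mem_nhds.2 ?_,
    (hJc.isPreconnected.image _ hτ.continuousOn).ordConnected, hτ,
    hmono.injOn.bijOn_image, fun t ht => (hpos t ht).ne'⟩
  rintro _ ⟨t, ht, rfl⟩
  have hs : HasStrictDerivAt τ (deriv τ t) t :=
    (hτ.contDiffAt (hJ.mem_nhds ht)).hasStrictDerivAt (by simp)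
  -- A nonzero strict derivative makes `τ` open at `t`.
  rw [← hs.map_nhds_eq (hpos t ht).ne']
  exact image_mem_map (hJ.mem_nhds ht)

theorem exists_inverse (h : IsReparametrization J' J τ) :
    ∃ σ : ℝ → ℝ, IsReparametrization J J' σ ∧ InvOn σ τ J' J ∧
      ∀ t ∈ J', HasDerivAt σ (deriv τ t)⁻¹ (τ t) := by
  obtain ⟨hJ', hJ'c, hJ, hJc, hτ, hbij, hne⟩ := h
  have hinv := hbij.invOn_invFunOn
  set σ := Function.invFunOn τ J'
  have hmaps : MapsTo σ J J' := hbij.surjOn.mapsTo_invFunOn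
  have hcd : ∀ t ∈ J', ContDiffAt ℝ ∞ τ t := fun t ht => hτ.contDiffAt (hJ'.mem_nhds ht)
  have hst : ∀ t ∈ J', HasStrictDerivAt τ (deriv τ t) t := fun t ht =>
    (hcd t ht).hasStrictDerivAt (by simp)
  have hev : ∀ t ∈ J', ∀ᶠ s in 𝓝 t, σ (τ s) = s := fun t ht =>
    eventually_of_mem (hJ'.mem_nhds ht) hinv.1
  have hder : ∀ t ∈ J', HasDerivAt σ (deriv τ t)⁻¹ (τ t) := fun t ht =>
    ((hst t ht).to_local_left_inverse (hne t ht) (hev t ht)).hasDerivAt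
  refine ⟨σ, ⟨hJ, hJc, hJ', hJ'c, ?_, ?_, ?_⟩, hinv, hder⟩
  · intro y hy
    obtain ⟨t, ht, rfl⟩ := hbij.surjOn hy
    -- Near `τ t` the global inverse `σ` coincides with the local inverse of the inverse function
    -- theorem, and inherits its smoothness.
    have hfd := (hst t ht).hasStrictFDerivAt_equiv (hne t ht)
    have huniq := hfd.localInverse_unique (hev t ht)
    have h1 := (hcd t ht).to_localInverse hfd.hasFDerivAt (by simp)
    exact (h1.congr_of_eventuallyEq huniq).contDiffWithinAt
  · exact hinv.symm.bijOn hmaps hbij.mapsTo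
  · intro y hy
    obtain ⟨t, ht, rfl⟩ := hbij.surjOn hy
    rw [(hder t ht).deriv]
    exact inv_ne_zero (hne t ht)

theorem differentiableAt (h : IsReparametrization J' J τ) {t : ℝ} (ht : t ∈ J') :
    DifferentiableAt ℝ τ t :=
  (h.2.2.2.2.1.contDiffAt (h.1.mem_nhds ht)).differentiableAt (by simp)

theorem mapsTo (h : IsReparametrization J' J τ) : MapsTo τ J' J := h.2.2.2.2.2.1.mapsTo

/-- Darboux: a derivative without zeros on an interval has constant sign. -/
theorem deriv_pos_or_neg (h : IsReparametrization J' J τ) :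
    (∀ t ∈ J', 0 < deriv τ t) ∨ ∀ t ∈ J', deriv τ t < 0 :=
  (hasDerivWithinAt_forall_lt_or_forall_gt_of_forall_ne h.2.1.convex
    (fun _ ht => (h.differentiableAt ht).hasDerivAt.hasDerivWithinAt) h.2.2.2.2.2.2).symm

theorem nonempty (h : IsReparametrization J' J τ) (hJ : J.Nonempty) : J'.Nonempty := by
  obtain ⟨y, hy⟩ := hJ
  obtain ⟨t, ht, -⟩ := h.2.2.2.2.2.1.surjOn hy
  exact ⟨t, ht⟩

end IsReparametrization

/-! ### Regular curves and loxodromes under changes of parameter. -/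

namespace OrientedSurface

variable {S : OrientedSurface} {J J' : Set ℝ} {γ : ℝ → E3} {τ : ℝ → ℝ}

namespace IsRegularCurve

theorem contDiffAt (h : S.IsRegularCurve J γ) {t : ℝ} (ht : t ∈ J) : ContDiffAt ℝ ∞ γ t :=
  h.2.2.2.1.contDiffAt (h.1.mem_nhds ht)

theorem hasDerivAt (h : S.IsRegularCurve J γ) {t : ℝ} (ht : t ∈ J) :
    HasDerivAt γ (deriv γ t) t :=
  ((h.contDiffAt ht).differentiableAt (by simp)).hasDerivAt

theorem contDiffOn_deriv (h : S.IsRegularCurve J γ) : ContDiffOn ℝ ∞ (deriv γ) J :=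
  h.2.2.2.1.deriv_of_isOpen h.1 (by simp)

theorem hasDerivAt_deriv (h : S.IsRegularCurve J γ) {t : ℝ} (ht : t ∈ J) :
    HasDerivAt (deriv γ) (deriv (deriv γ) t) t :=
  ((h.contDiffOn_deriv.contDiffAt (h.1.mem_nhds ht)).differentiableAt (by simp)).hasDerivAt

theorem deriv_mem (h : S.IsRegularCurve J γ) {t : ℝ} (ht : t ∈ J) :
    deriv γ t ∈ S.tangentPlane (γ t) :=
  hasDerivAt_mem_tangentPlane (h.hasDerivAt ht)
    (eventually_of_mem (h.1.mem_nhds ht) fun s hs => (h.2.2.2.2 s hs).1)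

theorem deriv_comp (h : S.IsRegularCurve J γ) (hτ : IsReparametrization J' J τ) {t : ℝ}
    (ht : t ∈ J') : deriv (γ ∘ τ) t = deriv τ t • deriv γ (τ t) :=
  ((h.hasDerivAt (hτ.mapsTo ht)).scomp t (hτ.differentiableAt ht).hasDerivAt).deriv

theorem comp (h : S.IsRegularCurve J γ) (hτ : IsReparametrization J' J τ) :
    S.IsRegularCurve J' (γ ∘ τ) := by
  refine ⟨hτ.1, hτ.2.1, hτ.nonempty h.2.2.1, h.2.2.2.1.comp hτ.2.2.2.2.1 hτ.mapsTo, ?_⟩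
  intro t ht
  refine ⟨(h.2.2.2.2 _ (hτ.mapsTo ht)).1, ?_⟩
  rw [h.deriv_comp hτ ht]
  exact smul_ne_zero (hτ.2.2.2.2.2.2 t ht) (h.2.2.2.2 _ (hτ.mapsTo ht)).2

theorem congr {δ : ℝ → E3} (h : S.IsRegularCurve J γ) (hδ : EqOn δ γ J) :
    S.IsRegularCurve J δ := by
  refine ⟨h.1, h.2.1, h.2.2.1, h.2.2.2.1.congr hδ, fun t ht => ?_⟩
  rw [hδ ht, (eventuallyEq_of_mem (h.1.mem_nhds ht) hδ).deriv_eq]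
  exact h.2.2.2.2 t ht

/-- Reparametrization by arc length. -/
theorem exists_unit_speed (h : S.IsRegularCurve J γ) :
    ∃ (J' : Set ℝ) (τ : ℝ → ℝ), IsReparametrization J' J τ ∧
      ∀ t ∈ J', ‖deriv (γ ∘ τ) t‖ = 1 := by
  obtain ⟨t₀, ht₀⟩ := h.2.2.1
  have hsm : ContDiffOn ℝ ∞ (fun u => ‖deriv γ u‖) J :=
    h.contDiffOn_deriv.norm ℝ fun t ht => (h.2.2.2.2 t ht).2
  have hder : ∀ t ∈ J, HasDerivAt (fun t => ∫ u in t₀..t, ‖deriv γ u‖) ‖deriv γ t‖ t := by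
    intro t ht
    refine intervalIntegral.integral_hasDerivAt_right ?_
      (hsm.continuousOn.stronglyMeasurableAtFilter h.1 t ht)
      (hsm.continuousOn.continuousAt (h.1.mem_nhds ht))
    exact (hsm.continuousOn.mono (h.2.1.uIcc_subset ht₀ ht)).intervalIntegrable
  -- The arc length measured from `t₀`; the required change of parameter is its inverse `σ`.
  set s : ℝ → ℝ := fun t => ∫ u in t₀..t, ‖deriv γ u‖
  have hs : IsReparametrization J (s '' J) s := by
    refine .of_deriv_pos h.1 h.2.1 ?_ fun t ht => ?_
    · rw [contDiffOn_infty_iff_deriv_of_isOpen h.1]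
      exact ⟨fun t ht => (hder t ht).differentiableAt.differentiableWithinAt,
        hsm.congr fun t ht => (hder t ht).deriv⟩
    · rw [(hder t ht).deriv]
      exact norm_pos_iff.2 (h.2.2.2.2 t ht).2
  obtain ⟨σ, hσ, hinv, hdσ⟩ := hs.exists_inverse
  refine ⟨s '' J, σ, hσ, ?_⟩
  rintro _ ⟨t, ht, rfl⟩
  rw [h.deriv_comp hσ (mem_image_of_mem s ht), (hdσ t ht).deriv, (hder t ht).deriv, hinv.1 ht,
    norm_smul, norm_inv, norm_norm]
  exact inv_mul_cancel₀ (norm_ne_zero_iff.2 (h.2.2.2.2 t ht).2)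

end IsRegularCurve

/-- The angle is kept when `τ` increases and becomes `π - α` when it decreases; the sign of `deriv
τ` cannot change along the interval. -/
theorem IsLoxodrome.comp (h : S.IsLoxodrome J γ) (hτ : IsReparametrization J' J τ) :
    S.IsLoxodrome J' (γ ∘ τ) := by
  obtain ⟨hreg, α, hα⟩ := h
  refine ⟨hreg.comp hτ, ?_⟩
  rcases hτ.deriv_pos_or_neg with hp | hn
  · refine ⟨α, fun t ht => ?_⟩
    rw [hreg.deriv_comp hτ ht, InnerProductGeometry.angle_smul_left_of_pos _ _ (hp t ht)]
    exact hα _ (hτ.mapsTo ht)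
  · refine ⟨Real.pi - α, fun t ht => ?_⟩
    rw [hreg.deriv_comp hτ ht, InnerProductGeometry.angle_smul_left_of_neg _ _ (hn t ht),
      InnerProductGeometry.angle_neg_left]
    exact congrArg _ (hα _ (hτ.mapsTo ht))

theorem IsLoxodrome.congr {δ : ℝ → E3} (h : S.IsLoxodrome J γ) (hδ : EqOn δ γ J) :
    S.IsLoxodrome J δ := by
  obtain ⟨hreg, α, hα⟩ := h
  refine ⟨hreg.congr hδ, α, fun t ht => ?_⟩
  rw [hδ ht, (eventuallyEq_of_mem (hreg.1.mem_nhds ht) hδ).deriv_eq]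
  exact hα t ht

/-! ### Geodesics of a connection with a parallel frame -/

/-- The covariant derivative `∇_γ' γ'` of the velocity of a curve. -/
def acceleration (S : OrientedSurface) (V : E3 → E3) (γ : ℝ → E3) (t : ℝ) : E3 :=
  S.tangentialPart (γ t) (deriv (deriv γ) t) + inner ℝ (deriv γ t) (deriv γ t) • V (γ t)
    - inner ℝ (V (γ t)) (deriv γ t) • deriv γ t

theorem acceleration_mem {V : E3 → E3} (hV : S.IsTangentField V) (h : S.IsRegularCurve J γ)
    {t : ℝ} (ht : t ∈ J) : S.acceleration V γ t ∈ S.tangentPlane (γ t) :=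
  have hp := (h.2.2.2.2 t ht).1
  sub_mem (add_mem (tangentialPart_mem hp _) (Submodule.smul_mem _ _ (hV.2 _ hp)))
    (Submodule.smul_mem _ _ (h.deriv_mem ht))

/-- The product rule of a metric connection along `γ`, in which the term containing the derivative
of `e` drops out. -/
theorem hasDerivAt_inner_deriv {V e : E3 → E3} (he : S.IsTangentField e) (hpar : S.IsParallel V e)
    (h : S.IsRegularCurve J γ) {t : ℝ} (ht : t ∈ J) :
    HasDerivAt (fun s => inner ℝ (e (γ s)) (deriv γ s))
      (inner ℝ (e (γ t)) (S.acceleration V γ t)) t := by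
  have hp := (h.2.2.2.2 t ht).1
  have hv := h.deriv_mem ht
  have hec := (he.1.differentiableAt hp).hasFDerivAt.comp_hasDerivAt t (h.hasDerivAt ht)
  refine (hec.inner ℝ (h.hasDerivAt_deriv ht)).congr_deriv ?_
  -- Parallelism expresses `g(∇^g_γ' e, γ')` through `V`; these terms match the `V`-terms of the
  -- acceleration paired with `e`.
  have h0 := congrArg (fun w => inner ℝ w (deriv γ t)) (hpar _ hp _ hv)
  simp only [conn, leviCivita, inner_sub_left, inner_add_left, inner_tangentialPart hv,
    inner_smul_left, inner_zero_left] at h0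
  simp only [acceleration, inner_sub_right, inner_add_right, inner_smul_right]
  rw [real_inner_comm (S.tangentialPart _ _), inner_tangentialPart (he.2 _ hp),
    real_inner_comm (V (γ t)) (e (γ t)), real_inner_comm (deriv γ t) (e (γ t)),
    real_inner_comm (e (γ t)) (deriv (deriv γ) t)]
  simp only [conj_trivial] at h0
  simp only [Function.comp_apply]
  linarith

variable {e₁ e₂ V : E3 → E3}

/-- The acceleration is tangent, and its frame components are the derivatives of the components of
the velocity. -/
theorem IsFrame.isGeodesic_iff (h : S.IsFrame e₁ e₂) (hV : S.IsTangentField V)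
    (h1 : S.IsParallel V e₁) (h2 : S.IsParallel V e₂) :
    S.IsGeodesic V J γ ↔ S.IsRegularCurve J γ ∧
      (∃ A : ℝ, ∀ t ∈ J, inner ℝ (e₁ (γ t)) (deriv γ t) = A) ∧
      ∃ B : ℝ, ∀ t ∈ J, inner ℝ (e₂ (γ t)) (deriv γ t) = B := by
  refine and_congr_right fun hreg => ?_
  have key : ∀ e, S.IsTangentField e → S.IsParallel V e →
      ((∃ A : ℝ, ∀ t ∈ J, inner ℝ (e (γ t)) (deriv γ t) = A) ↔
        ∀ t ∈ J, inner ℝ (e (γ t)) (S.acceleration V γ t) = 0) := by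
    intro e he hpar
    constructor
    · rintro ⟨A, hA⟩ t ht
      exact (hasDerivAt_inner_deriv he hpar hreg ht).unique
        ((hasDerivAt_const t A).congr_of_eventuallyEq
          (eventuallyEq_of_mem (hreg.1.mem_nhds ht) hA))
    · intro h0
      refine hreg.1.exists_is_const_of_deriv_eq_zero hreg.2.1.isPreconnected
        (fun t ht =>
          (hasDerivAt_inner_deriv he hpar hreg ht).differentiableAt.differentiableWithinAt)
        fun t ht => ?_
      rw [(hasDerivAt_inner_deriv he hpar hreg ht).deriv, h0 t ht, Pi.zero_apply]
  rw [key _ h.tangent_fst h1, key _ h.tangent_snd h2]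
  constructor
  · intro hg
    have hg' : ∀ t ∈ J, S.acceleration V γ t = 0 := hg
    exact ⟨fun t ht => by rw [hg' t ht, inner_zero_right],
      fun t ht => by rw [hg' t ht, inner_zero_right]⟩
  · rintro ⟨ha, hb⟩ t ht
    exact h.eq_zero (hreg.2.2.2.2 t ht).1 (acceleration_mem hV hreg ht) (ha t ht) (hb t ht)

theorem IsFrame.norm_sq_deriv (h : S.IsFrame e₁ e₂) (hreg : S.IsRegularCurve J γ) {t : ℝ}
    (ht : t ∈ J) : ‖deriv γ t‖ ^ 2 =
      inner ℝ (e₁ (γ t)) (deriv γ t) ^ 2 + inner ℝ (e₂ (γ t)) (deriv γ t) ^ 2 := by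
  rw [← real_inner_self_eq_norm_sq, h.inner_eq (hreg.2.2.2.2 t ht).1 (hreg.deriv_mem ht)]
  ring

theorem IsFrame.isGeodesic_iff_isLoxodrome (h : S.IsFrame S.meridianDir e₂)
    (hV : S.IsTangentField V) (h1 : S.IsParallel V S.meridianDir) (h2 : S.IsParallel V e₂) :
    S.IsGeodesic V J γ ↔ S.IsLoxodrome J γ ∧ ∃ E : ℝ, ∀ t ∈ J, ‖deriv γ t‖ = E := by
  rw [h.isGeodesic_iff hV h1 h2, IsLoxodrome, and_assoc]
  refine and_congr_right fun hreg => ?_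
  constructor
  · rintro ⟨⟨A, hA⟩, B, hB⟩
    have hE : ∀ t ∈ J, ‖deriv γ t‖ = √(A ^ 2 + B ^ 2) := by
      intro t ht
      rw [← hA t ht, ← hB t ht, ← h.norm_sq_deriv hreg ht, Real.sqrt_sq (norm_nonneg _)]
    refine ⟨⟨Real.arccos (A / √(A ^ 2 + B ^ 2)), fun t ht => ?_⟩, _, hE⟩
    rw [InnerProductGeometry.angle, hE t ht, h.norm_fst _ (hreg.2.2.2.2 t ht).1, mul_one,
      real_inner_comm, hA t ht]
  · rintro ⟨⟨α, hα⟩, E, hE⟩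
    have hA : ∀ t ∈ J, inner ℝ (S.meridianDir (γ t)) (deriv γ t) = Real.cos α * E := by
      intro t ht
      have := InnerProductGeometry.cos_angle_mul_norm_mul_norm (deriv γ t) (S.meridianDir (γ t))
      rw [hα t ht, hE t ht, h.norm_fst _ (hreg.2.2.2.2 t ht).1, mul_one] at this
      rw [real_inner_comm, this]
    refine ⟨⟨_, hA⟩, ?_⟩
    have hB : ∀ t ∈ J, inner ℝ (e₂ (γ t)) (deriv γ t) ^ 2 = E ^ 2 - (Real.cos α * E) ^ 2 := by
      intro t ht
      rw [← hA t ht, ← hE t ht, h.norm_sq_deriv hreg ht]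
      ring
    have hd := fun t ht => hasDerivAt_inner_deriv (t := t) h.tangent_snd h2 hreg ht
    refine hreg.1.exists_is_const_of_deriv_eq_zero hreg.2.1.isPreconnected
      (fun t ht => (hd t ht).differentiableAt.differentiableWithinAt) fun t ht => ?_
    rw [(hd t ht).deriv, Pi.zero_apply]
    -- Angle and speed determine the `e₂`-component `B` only up to sign, but `B²` is constant.
    -- Either `B` vanishes at `t`, hence everywhere, or `2 B B' = 0` gives `B' = 0` at `t`.
    by_cases h0 : inner ℝ (e₂ (γ t)) (deriv γ t) = 0
    · refine (hd t ht).unique ((hasDerivAt_const t (0 : ℝ)).congr_of_eventuallyEq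
        (eventuallyEq_of_mem (hreg.1.mem_nhds ht) fun s hs => ?_))
      have := hB s hs
      rw [← hB t ht, h0] at this
      simpa using this
    · have := ((hd t ht).pow 2).unique ((hasDerivAt_const t _).congr_of_eventuallyEq
        (eventuallyEq_of_mem (hreg.1.mem_nhds ht) hB))
      simpa [h0] using this

theorem IsFrame.isLoxodrome_iff_isGeodesicUpToParam (h : S.IsFrame S.meridianDir e₂)
    (hV : S.IsTangentField V) (h1 : S.IsParallel V S.meridianDir) (h2 : S.IsParallel V e₂) :
    S.IsLoxodrome J γ ↔ S.IsGeodesicUpToParam V J γ := by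
  constructor
  · intro hl
    obtain ⟨J', τ, hτ, h1'⟩ := hl.1.exists_unit_speed
    exact ⟨J', τ, hτ, (h.isGeodesic_iff_isLoxodrome hV h1 h2).2 ⟨hl.comp hτ, 1, h1'⟩⟩
  · rintro ⟨J', τ, hτ, hg⟩
    obtain ⟨σ, hσ, hinv, -⟩ := hτ.exists_inverse
    -- Undoing the reparametrization recovers `γ` on `J` only, hence the passage through `congr`.
    refine (((h.isGeodesic_iff_isLoxodrome hV h1 h2).1 hg).1.comp hσ).congr fun t ht => ?_
    simp [hinv.2 ht]

end OrientedSurface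

/-! ### Surfaces of revolution -/

theorem fderiv_apply_coord {f : E3 → E3} {p : E3} (hf : DifferentiableAt ℝ f p) (v : E3)
    (i : Fin 3) : fderiv ℝ f p v i = fderiv ℝ (fun q => f q i) p v := by
  have := ((EuclideanSpace.proj i : E3 →L[ℝ] ℝ).hasFDerivAt.comp p hf.hasFDerivAt).fderiv
  exact (DFunLike.congr_fun this v).symm

theorem axisDist_sq (p : E3) : axisDist p ^ 2 = p 0 ^ 2 + p 1 ^ 2 :=
  Real.sq_sqrt (by positivity)

theorem isOpen_axisDist_pos : IsOpen {q : E3 | 0 < axisDist q} := by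
  refine isOpen_lt continuous_const ?_
  have := fun i => (contDiff_coord i).continuous
  unfold axisDist
  fun_prop

theorem contDiffAt_axisDist {p : E3} (hp : 0 < axisDist p) : ContDiffAt ℝ ∞ axisDist p := by
  refine ContDiffAt.sqrt ?_ (Real.sqrt_pos.1 hp).ne'
  exact (((contDiff_coord 0).pow 2).add ((contDiff_coord 1).pow 2)).contDiffAt

theorem hasFDerivAt_axisDist {p : E3} (hp : 0 < axisDist p) :
    HasFDerivAt axisDist ((p 0 / axisDist p) • (EuclideanSpace.proj 0 : E3 →L[ℝ] ℝ)
      + (p 1 / axisDist p) • (EuclideanSpace.proj 1 : E3 →L[ℝ] ℝ)) p := by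
  have h := (((hasFDerivAt_coord 0 p).pow 2).add ((hasFDerivAt_coord 1 p).pow 2)).sqrt
    (Real.sqrt_pos.1 hp).ne'
  refine h.congr_fderiv ?_
  ext v
  have : axisDist p ≠ 0 := hp.ne'
  have hr : √(p 0 ^ 2 + p 1 ^ 2) = axisDist p := rfl
  simp [hr]
  field_simp

theorem gradient_log_axisDist {p : E3} (hp : 0 < axisDist p) :
    gradient (fun q => Real.log (axisDist q)) p =
      !₂[p 0 / axisDist p ^ 2, p 1 / axisDist p ^ 2, 0] := by
  refine (hasGradientAt_of_coord ?_).gradient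
  refine ((hasFDerivAt_axisDist hp).log hp.ne').congr_fderiv ?_
  ext v
  simp
  field_simp

theorem contDiffAt_parallelDir {p : E3} (hp : 0 < axisDist p) :
    ContDiffAt ℝ ∞ parallelDir p := by
  refine ((contDiffAt_axisDist hp).inv hp.ne').smul ?_
  refine ContDiff.contDiffAt ?_
  rw [contDiff_euclidean]
  intro i
  fin_cases i
  · exact (contDiff_coord 1).neg
  · exact contDiff_coord 0
  · exact contDiff_const

theorem norm_parallelDir {p : E3} (hp : 0 < axisDist p) : ‖parallelDir p‖ = 1 := by
  rw [← sq_eq_sq₀ (norm_nonneg _) zero_le_one, ← real_inner_self_eq_norm_sq, inner_eq_coord]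
  have := axisDist_sq p
  simp [parallelDir]
  field_simp
  linarith

/-- The vector on the right is the gradient of `log r`; this is where the choice of `V` comes from.
-/
theorem fderiv_parallelDir {p : E3} (hp : 0 < axisDist p) (v : E3) :
    fderiv ℝ parallelDir p v =
      -inner ℝ v (parallelDir p) • !₂[p 0 / axisDist p ^ 2, p 1 / axisDist p ^ 2, 0] := by
  have hr := axisDist_sq p
  have hd := (contDiffAt_parallelDir hp).differentiableAt (by simp)
  have hi := (hasDerivAt_inv hp.ne').comp_hasFDerivAt p (hasFDerivAt_axisDist hp)
  ext i
  rw [fderiv_apply_coord hd]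
  fin_cases i
  · have h := hi.mul (hasFDerivAt_coord 1 p).neg
    have h' : HasFDerivAt (fun q => parallelDir q 0) _ p := h
    simp only [Fin.zero_eta]
    rw [h'.fderiv, inner_eq_coord]
    simp [parallelDir]
    field_simp
    rw [hr]
    ring
  · have h := hi.mul (hasFDerivAt_coord 0 p)
    have h' : HasFDerivAt (fun q => parallelDir q 1) _ p := h
    simp only [Fin.mk_one]
    rw [h'.fderiv, inner_eq_coord]
    simp [parallelDir]
    field_simp
    rw [hr]
    ring
  · have h' : (fun q => parallelDir q 2) = fun _ => (0 : ℝ) := by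
      ext q
      simp [parallelDir]
    simp [h']

/-- Exhibits a multiple of `e₂` as the velocity of a rotation orbit, so that rotation invariance
makes `e₂` tangent. -/
theorem hasDerivAt_rotation_zero (p : E3) :
    HasDerivAt (fun θ => rotation θ p) (axisDist p • parallelDir p) 0 := by
  rw [hasDerivAt_iff_hasFDerivAt, ← hasFDerivWithinAt_univ, hasFDerivWithinAt_euclidean]
  have hs := Real.hasDerivAt_sin 0
  have hc := Real.hasDerivAt_cos 0
  have hv : axisDist p • parallelDir p = !₂[-p 1, p 0, 0] := by
    -- On the axis both sides vanish.
    rcases eq_or_ne (axisDist p) 0 with h | h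
    · have h2 := axisDist_sq p
      rw [h] at h2
      have h0 : p 0 = 0 := by nlinarith
      have h1 : p 1 = 0 := by nlinarith
      ext i; fin_cases i <;> simp [h, h0, h1]
    · rw [parallelDir, smul_inv_smul₀ h]
  rw [hv]
  intro i
  fin_cases i
  · refine ((hc.mul_const (p 0)).sub (hs.mul_const (p 1))).hasFDerivAt.hasFDerivWithinAt.congr_fderiv ?_
    ext
    simp
  · refine ((hs.mul_const (p 0)).add (hc.mul_const (p 1))).hasFDerivAt.hasFDerivWithinAt.congr_fderiv ?_
    ext
    simp
  · refine (hasDerivAt_const (0 : ℝ) (p 2)).hasFDerivAt.hasFDerivWithinAt.congr_fderiv ?_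
    ext
    simp

theorem rotation_zero (p : E3) : rotation 0 p = p := by
  ext i
  fin_cases i <;> simp [rotation]

namespace OrientedSurface

variable {S : OrientedSurface}

theorem meridianDir_eq (p : E3) : S.meridianDir p =
    !₂[parallelDir p 1 * S.normal p 2 - parallelDir p 2 * S.normal p 1,
      parallelDir p 2 * S.normal p 0 - parallelDir p 0 * S.normal p 2,
      parallelDir p 0 * S.normal p 1 - parallelDir p 1 * S.normal p 0] := by
  simp [meridianDir, cross_apply]

theorem inner_meridianDir_parallelDir (p : E3) :
    inner ℝ (S.meridianDir p) (parallelDir p) = 0 := by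
  rw [inner_eq_coord, meridianDir_eq]
  simp
  ring

theorem inner_normal_meridianDir (p : E3) :
    inner ℝ (S.normal p) (S.meridianDir p) = 0 := by
  rw [inner_eq_coord, meridianDir_eq]
  simp
  ring

namespace IsSurfaceOfRevolution

variable (h : S.IsSurfaceOfRevolution)
include h

theorem parallelDir_mem {p : E3} (hp : p ∈ S.carrier) : parallelDir p ∈ S.tangentPlane p := by
  have h0 := hasDerivAt_mem_tangentPlane (hasDerivAt_rotation_zero p)
    (Eventually.of_forall fun θ => h.2 p hp θ)
  rw [rotation_zero] at h0
  exact (Submodule.smul_mem_iff _ (h.1 p hp).ne').1 h0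

theorem isTangentField_parallelDir : S.IsTangentField parallelDir :=
  ⟨⟨_, isOpen_axisDist_pos, h.1, fun _ hq => (contDiffAt_parallelDir hq).contDiffWithinAt⟩,
    fun _ hp => h.parallelDir_mem hp⟩

theorem isTangentField_meridianDir : S.IsTangentField S.meridianDir := by
  refine ⟨?_, fun p _ => mem_tangentPlane.2 (inner_normal_meridianDir p)⟩
  obtain ⟨O, hO, hSO, hN⟩ := S.normal_smooth
  obtain ⟨O', hO', hSO', hP⟩ := h.isTangentField_parallelDir.1
  refine ⟨O ∩ O', hO.inter hO', subset_inter hSO hSO', ?_⟩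
  have hN' := contDiffOn_euclidean.1 (hN.mono (inter_subset_left (t := O')))
  have hP' := contDiffOn_euclidean.1 (hP.mono (inter_subset_right (s := O)))
  rw [show S.meridianDir = _ from funext meridianDir_eq, contDiffOn_euclidean]
  intro i
  fin_cases i
  · exact ((hP' 1).mul (hN' 2)).sub ((hP' 2).mul (hN' 1))
  · exact ((hP' 2).mul (hN' 0)).sub ((hP' 0).mul (hN' 2))
  · exact ((hP' 0).mul (hN' 1)).sub ((hP' 1).mul (hN' 0))

theorem isFrame : S.IsFrame S.meridianDir parallelDir where
  tangent_fst := h.isTangentField_meridianDir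
  tangent_snd := h.isTangentField_parallelDir
  norm_fst p hp := by
    have h1 := norm_parallelDir (h.1 p hp)
    have h2 := S.normal_unit p hp
    have h3 := mem_tangentPlane.1 (h.parallelDir_mem hp)
    rw [← sq_eq_sq₀ (norm_nonneg _) zero_le_one, ← real_inner_self_eq_norm_sq,
      inner_eq_coord] at h1 h2 ⊢
    rw [inner_eq_coord] at h3
    rw [meridianDir_eq]
    set a := parallelDir p
    set n := S.normal p
    simp only [Matrix.cons_val_zero, Matrix.cons_val_one, Matrix.cons_val]
    -- Lagrange's identity `|a × n|² = |a|² |n|² - ⟨a, n⟩²`.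
    linear_combination (n 0 * n 0 + n 1 * n 1 + n 2 * n 2) * h1 + h2
      - (n 0 * a 0 + n 1 * a 1 + n 2 * a 2) * h3
  norm_snd p hp := norm_parallelDir (h.1 p hp)
  inner_eq_zero p _ := inner_meridianDir_parallelDir p

theorem isTangentField_revolutionField : S.IsTangentField S.revolutionField := by
  refine ⟨?_, fun p hp => tangentialPart_mem hp _⟩
  refine smoothNear_tangentialPart ⟨_, isOpen_axisDist_pos, h.1, ?_⟩
  refine ContDiffOn.congr (f := fun q : E3 => !₂[q 0 / axisDist q ^ 2, q 1 / axisDist q ^ 2, 0])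
    ?_ fun q hq => gradient_log_axisDist hq
  rw [contDiffOn_euclidean]
  intro i
  have hr : ContDiffOn ℝ ∞ (fun q => axisDist q ^ 2) {q : E3 | 0 < axisDist q} := fun q hq =>
    ((contDiffAt_axisDist hq).pow 2).contDiffWithinAt
  have hne : ∀ q ∈ {q : E3 | 0 < axisDist q}, axisDist q ^ 2 ≠ 0 := fun q hq =>
    pow_ne_zero 2 (ne_of_gt hq)
  fin_cases i
  · exact (contDiff_coord 0).contDiffOn.div hr hne
  · exact (contDiff_coord 1).contDiffOn.div hr hne
  · exact contDiffOn_const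

/-- The tangential part of `fderiv_parallelDir` is `-g(v, e₂) V`, the opposite of the torsion term,
and `V` is orthogonal to `e₂`. -/
theorem isParallel_parallelDir : S.IsParallel S.revolutionField parallelDir := by
  intro p hp v hv
  have hr := h.1 p hp
  have h0 : inner ℝ (S.revolutionField p) (parallelDir p) = 0 := by
    rw [revolutionField, grad, inner_tangentialPart (h.parallelDir_mem hp),
      gradient_log_axisDist hr, inner_eq_coord]
    simp [parallelDir]
    ring
  rw [conn, h0, leviCivita, fderiv_parallelDir hr, tangentialPart_smul, revolutionField, grad,
    gradient_log_axisDist hr]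
  module

theorem isParallel_meridianDir : S.IsParallel S.revolutionField S.meridianDir :=
  h.isFrame.isParallel_fst h.isTangentField_revolutionField h.isParallel_parallelDir

theorem isFlat_revolutionField : S.IsFlat S.revolutionField :=
  h.isFrame.isFlat h.isTangentField_revolutionField h.isParallel_meridianDir
    h.isParallel_parallelDir

theorem isGeodesic_iff {J : Set ℝ} {γ : ℝ → E3} : S.IsGeodesic S.revolutionField J γ ↔
    S.IsLoxodrome J γ ∧ ∃ E : ℝ, ∀ t ∈ J, ‖deriv γ t‖ = E :=
  h.isFrame.isGeodesic_iff_isLoxodrome h.isTangentField_revolutionField h.isParallel_meridianDir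
    h.isParallel_parallelDir

theorem isLoxodrome_iff {J : Set ℝ} {γ : ℝ → E3} :
    S.IsLoxodrome J γ ↔ S.IsGeodesicUpToParam S.revolutionField J γ :=
  h.isFrame.isLoxodrome_iff_isGeodesicUpToParam h.isTangentField_revolutionField
    h.isParallel_meridianDir h.isParallel_parallelDir

end IsSurfaceOfRevolution

end OrientedSurface

/-! ### The shape operator in a frame of principal directions -/

namespace OrientedSurface

variable {S : OrientedSurface} {e₁ e₂ : E3 → E3}

theorem shapeOperator_eq_smul {p v : E3} {c : ℝ} (hv : v ∈ S.tangentPlane p)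
    (h : fderiv ℝ S.normal p v = c • v) :
    S.shapeOperator p ⟨v, hv⟩ = (-c) • (⟨v, hv⟩ : S.tangentPlane p) := by
  have h1 : S.shapeOperator p ⟨v, hv⟩ =
      (S.tangentPlane p).orthogonalProjectionOnto (-(fderiv ℝ S.normal p v)) := rfl
  rw [h1, h, ← neg_smul, map_smul]
  congr 1
  exact Submodule.orthogonalProjectionOnto_mem_subspace_eq_self (⟨v, hv⟩ : S.tangentPlane p)

theorem IsFrame.exists_basis (h : S.IsFrame e₁ e₂) {p : E3} (hp : p ∈ S.carrier) :
    ∃ b : Module.Basis (Fin 2) ℝ (S.tangentPlane p),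
      b 0 = ⟨e₁ p, h.tangent_fst.2 p hp⟩ ∧ b 1 = ⟨e₂ p, h.tangent_snd.2 p hp⟩ := by
  set w : Fin 2 → S.tangentPlane p :=
    ![⟨e₁ p, h.tangent_fst.2 p hp⟩, ⟨e₂ p, h.tangent_snd.2 p hp⟩] with hw
  have ho : Orthonormal ℝ w := by
    have h12 := h.inner_eq_zero p hp
    have h21 : inner ℝ (e₂ p) (e₁ p) = 0 := by rw [real_inner_comm, h12]
    have n1 := h.norm_fst p hp
    have n2 := h.norm_snd p hp
    constructor
    · intro i; fin_cases i <;> simpa [hw]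
    · intro i j hij; fin_cases i <;> fin_cases j <;> simp_all
  have hspan : ⊤ ≤ Submodule.span ℝ (range w) := by
    rintro ⟨v, hv⟩ -
    have hx : (⟨v, hv⟩ : S.tangentPlane p) =
        inner ℝ (e₁ p) v • w 0 + inner ℝ (e₂ p) v • w 1 :=
      Subtype.ext (h.expansion hp hv).symm
    rw [hx]
    exact add_mem (Submodule.smul_mem _ _ (Submodule.subset_span (mem_range_self 0)))
      (Submodule.smul_mem _ _ (Submodule.subset_span (mem_range_self 1)))
  exact ⟨Module.Basis.mk ho.linearIndependent hspan, by simp [hw], by simp [hw]⟩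

theorem IsFrame.trace_det_shapeOperator (h : S.IsFrame e₁ e₂) {p : E3} (hp : p ∈ S.carrier)
    {c₁ c₂ : ℝ} (h1 : fderiv ℝ S.normal p (e₁ p) = c₁ • e₁ p)
    (h2 : fderiv ℝ S.normal p (e₂ p) = c₂ • e₂ p) :
    LinearMap.trace ℝ _ (S.shapeOperator p) = -c₁ - c₂ ∧ S.gaussianCurvature p = c₁ * c₂ := by
  obtain ⟨b, hb0, hb1⟩ := h.exists_basis hp
  have hM : LinearMap.toMatrix b b (S.shapeOperator p) = !![-c₁, 0; 0, -c₂] := by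
    have s1 := shapeOperator_eq_smul (h.tangent_fst.2 p hp) h1
    have s2 := shapeOperator_eq_smul (h.tangent_snd.2 p hp) h2
    rw [← hb0] at s1
    rw [← hb1] at s2
    ext i j
    rw [LinearMap.toMatrix_apply]
    fin_cases i <;> fin_cases j <;> simp [s1, s2]
  rw [gaussianCurvature, LinearMap.trace_eq_matrix_trace ℝ b, ← LinearMap.det_toMatrix b, hM]
  constructor
  · simp [Matrix.trace_fin_two]
    ring
  · simp [Matrix.det_fin_two]

end OrientedSurface

/-! ### The punctured sphere -/

theorem axisDist_rotation (θ : ℝ) (p : E3) : axisDist (rotation θ p) = axisDist p := by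
  have := Real.sin_sq_add_cos_sq θ
  simp only [axisDist, rotation]
  congr 1
  simp only [Matrix.cons_val_zero, Matrix.cons_val_one]
  linear_combination (p 0 ^ 2 + p 1 ^ 2) * this

theorem rotation_apply_two (θ : ℝ) (p : E3) : rotation θ p 2 = p 2 := by
  simp [rotation]

theorem mem_puncturedSphere {p : E3} :
    p ∈ puncturedSphere.carrier ↔ p 0 ^ 2 + p 1 ^ 2 + p 2 ^ 2 = 1 ∧ 0 < axisDist p := Iff.rfl

theorem isSurfaceOfRevolution_puncturedSphere : puncturedSphere.IsSurfaceOfRevolution := by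
  refine ⟨fun p hp => hp.2, fun p hp θ => ?_⟩
  rw [mem_puncturedSphere, ← axisDist_sq, axisDist_rotation, rotation_apply_two, axisDist_sq]
  exact hp

theorem gaussianCurvature_puncturedSphere {p : E3} (hp : p ∈ puncturedSphere.carrier) :
    puncturedSphere.gaussianCurvature p = 1 := by
  have hd : ∀ v, fderiv ℝ puncturedSphere.normal p v = (1 : ℝ) • v := by
    intro v
    have : puncturedSphere.normal = fun q => q := rfl
    rw [this, fderiv_fun_id]
    simp
  rw [(isSurfaceOfRevolution_puncturedSphere.isFrame.trace_det_shapeOperator hp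
    (hd _) (hd _)).2, one_mul]

/-! ### The catenoid -/

section Catenoid

variable {a : ℝ} {ha : 0 < a}

theorem mem_catenoid {p : E3} : p ∈ (catenoid a ha).carrier ↔
    p 0 ^ 2 + p 1 ^ 2 = a ^ 2 * Real.cosh (p 2 / a) ^ 2 := Iff.rfl

theorem catenoid_normal (p : E3) : (catenoid a ha).normal p =
    !₂[-p 0 / (a * Real.cosh (p 2 / a) ^ 2),
    -p 1 / (a * Real.cosh (p 2 / a) ^ 2), Real.sinh (p 2 / a) / Real.cosh (p 2 / a)] := rfl

theorem axisDist_of_mem_catenoid {p : E3} (hp : p ∈ (catenoid a ha).carrier) :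
    axisDist p = a * Real.cosh (p 2 / a) := by
  have := Real.cosh_pos (p 2 / a)
  rw [axisDist, mem_catenoid.1 hp, ← mul_pow, Real.sqrt_sq (by positivity)]

theorem isSurfaceOfRevolution_catenoid : (catenoid a ha).IsSurfaceOfRevolution := by
  refine ⟨fun p hp => ?_, fun p hp θ => ?_⟩
  · have := Real.cosh_pos (p 2 / a)
    rw [axisDist_of_mem_catenoid hp]
    positivity
  · rw [mem_catenoid, ← axisDist_sq, axisDist_rotation, rotation_apply_two, axisDist_sq]
    exact hp

theorem contDiff_catenoid_normal : ContDiff ℝ ∞ (catenoid a ha).normal := by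
  have hc := fun i => contDiff_coord i
  have hpos : ∀ q : E3, Real.cosh (q 2 / a) ≠ 0 := fun q => (Real.cosh_pos _).ne'
  have hz : ContDiff ℝ ∞ (fun q : E3 => q 2 / a) := (hc 2).div_const a
  have hne : ∀ q : E3, a * Real.cosh (q 2 / a) ^ 2 ≠ 0 :=
    fun q => mul_ne_zero ha.ne' (pow_ne_zero _ (hpos q))
  rw [contDiff_euclidean]
  intro i
  fin_cases i
  · exact (hc 0).neg.div (contDiff_const.mul (hz.cosh.pow 2)) hne
  · exact (hc 1).neg.div (contDiff_const.mul (hz.cosh.pow 2)) hne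
  · exact hz.sinh.div hz.cosh hpos

theorem differentiable_catenoid_normal : Differentiable ℝ (catenoid a ha).normal :=
  contDiff_catenoid_normal.differentiable (by simp)

/-- The conformal factor of the Gauss map of the catenoid. -/
def gaussFactor (a : ℝ) (p : E3) : ℝ := (a * Real.cosh (p 2 / a) ^ 2)⁻¹

theorem gaussFactor_pos (ha : 0 < a) (p : E3) : 0 < gaussFactor a p := by
  have := Real.cosh_pos (p 2 / a)
  unfold gaussFactor
  positivity

theorem hasFDerivAt_gaussFactor (ha : 0 < a) (p : E3) :
    HasFDerivAt (gaussFactor a) ((-2 * Real.sinh (p 2 / a) / (a ^ 2 * Real.cosh (p 2 / a) ^ 3)) •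
      (EuclideanSpace.proj 2 : E3 →L[ℝ] ℝ)) p := by
  have hC := Real.cosh_pos (p 2 / a)
  have hz : HasFDerivAt (fun q : E3 => q 2 / a)
      (a⁻¹ • (EuclideanSpace.proj 2 : E3 →L[ℝ] ℝ)) p := by
    simpa [div_eq_inv_mul] using (hasFDerivAt_coord 2 p).const_mul a⁻¹
  have h := (hasDerivAt_inv (x := a * Real.cosh (p 2 / a) ^ 2) (by positivity)).comp_hasFDerivAt p
    ((hz.cosh.pow 2).const_mul a)
  refine h.congr_fderiv ?_
  ext v
  simp
  field_simp

/-- With `k = gaussFactor a`, the normal is `(-k x, -k y, tanh (z/a))`; `k` is also the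
`z`-derivative of the last entry, and `dk = -2 k sinh (z/a) / (a cosh (z/a)) dz`. -/
theorem fderiv_catenoid_normal (p v : E3) : fderiv ℝ (catenoid a ha).normal p v =
    gaussFactor a p • !₂[-v 0 + 2 * Real.sinh (p 2 / a) / (a * Real.cosh (p 2 / a)) * p 0 * v 2,
      -v 1 + 2 * Real.sinh (p 2 / a) / (a * Real.cosh (p 2 / a)) * p 1 * v 2, v 2] := by
  have hC := Real.cosh_pos (p 2 / a)
  have hk := hasFDerivAt_gaussFactor ha p
  ext i
  rw [fderiv_apply_coord (differentiable_catenoid_normal p)]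
  fin_cases i
  · have h : HasFDerivAt (fun q => (catenoid a ha).normal q 0) _ p :=
      ((hasFDerivAt_coord 0 p).neg).mul hk
    simp only [Fin.zero_eta]
    rw [h.fderiv]
    simp [gaussFactor]
    field_simp
    ring
  · have h : HasFDerivAt (fun q => (catenoid a ha).normal q 1) _ p :=
      ((hasFDerivAt_coord 1 p).neg).mul hk
    simp only [Fin.mk_one]
    rw [h.fderiv]
    simp [gaussFactor]
    field_simp
    ring
  · have hz : HasFDerivAt (fun q : E3 => q 2 / a)
        (a⁻¹ • (EuclideanSpace.proj 2 : E3 →L[ℝ] ℝ)) p := by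
      simpa [div_eq_inv_mul] using (hasFDerivAt_coord 2 p).const_mul a⁻¹
    have h : HasFDerivAt (fun q => (catenoid a ha).normal q 2) _ p :=
      hz.sinh.mul ((hasDerivAt_inv hC.ne').comp_hasFDerivAt p hz.cosh)
    simp only [Fin.reduceFinMk]
    rw [h.fderiv]
    have h1 := Real.cosh_sq (p 2 / a)
    simp [gaussFactor]
    field_simp
    linear_combination v 2 * h1

theorem parallelDir_of_mem_catenoid {p : E3} (hp : p ∈ (catenoid a ha).carrier) :
    parallelDir p = (a * Real.cosh (p 2 / a))⁻¹ • !₂[-p 1, p 0, 0] := by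
  rw [parallelDir, axisDist_of_mem_catenoid hp]

theorem meridianDir_catenoid {p : E3} (hp : p ∈ (catenoid a ha).carrier) :
    (catenoid a ha).meridianDir p = (a * Real.cosh (p 2 / a) ^ 2)⁻¹ •
      !₂[p 0 * Real.sinh (p 2 / a), p 1 * Real.sinh (p 2 / a), a * Real.cosh (p 2 / a)] := by
  have hC := Real.cosh_pos (p 2 / a)
  have hp' := mem_catenoid.1 hp
  rw [OrientedSurface.meridianDir_eq, parallelDir_of_mem_catenoid hp, catenoid_normal]
  ext i
  fin_cases i
  · simp
    field_simp
  · simp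
    field_simp
  · simp
    field_simp
    linarith

/-- Meridians and parallels are lines of curvature. The opposite factors found here and in
`fderiv_normal_parallelDir` carry minimality, the curvature and conformality. -/
theorem fderiv_normal_meridianDir {p : E3} (hp : p ∈ (catenoid a ha).carrier) :
    fderiv ℝ (catenoid a ha).normal p ((catenoid a ha).meridianDir p) =
      gaussFactor a p • (catenoid a ha).meridianDir p := by
  have hC := Real.cosh_pos (p 2 / a)
  rw [fderiv_catenoid_normal, meridianDir_catenoid hp]
  congr 1
  ext i
  fin_cases i
  · simp
    field_simp
    ring
  · simp
    field_simp
    ring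
  · simp

theorem fderiv_normal_parallelDir {p : E3} (hp : p ∈ (catenoid a ha).carrier) :
    fderiv ℝ (catenoid a ha).normal p (parallelDir p) =
      (-gaussFactor a p) • parallelDir p := by
  rw [fderiv_catenoid_normal, parallelDir_of_mem_catenoid hp, neg_smul, ← smul_neg]
  congr 1
  ext i
  fin_cases i <;> simp

theorem isMinimal_catenoid : (catenoid a ha).IsMinimal := by
  intro p hp
  rw [(isSurfaceOfRevolution_catenoid.isFrame.trace_det_shapeOperator hp
    (fderiv_normal_meridianDir hp) (fderiv_normal_parallelDir hp)).1]
  ring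

theorem gaussianCurvature_catenoid {p : E3} (hp : p ∈ (catenoid a ha).carrier) :
    (catenoid a ha).gaussianCurvature p = -gaussFactor a p ^ 2 := by
  rw [(isSurfaceOfRevolution_catenoid.isFrame.trace_det_shapeOperator hp
    (fderiv_normal_meridianDir hp) (fderiv_normal_parallelDir hp)).2]
  ring

theorem not_hasConstantCurvature_catenoid : ¬ (catenoid a ha).HasConstantCurvature := by
  rintro ⟨k, hk⟩
  -- A point of the waist is compared with one at height `a`: equal curvatures would force `cosh 1 =
  -- ±1`.
  have h0 : (!₂[a, 0, 0] : E3) ∈ (catenoid a ha).carrier := by simp [mem_catenoid]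
  have h1 : (!₂[a * Real.cosh 1, 0, a] : E3) ∈ (catenoid a ha).carrier := by
    simp [mem_catenoid, div_self ha.ne', mul_pow]
  have hC : 1 < Real.cosh 1 := Real.one_lt_cosh.2 one_ne_zero
  have h : -gaussFactor a !₂[a, 0, 0] ^ 2 = -gaussFactor a !₂[a * Real.cosh 1, 0, a] ^ 2 := by
    rw [← gaussianCurvature_catenoid h0, ← gaussianCurvature_catenoid h1, hk _ h0, hk _ h1]
  rw [neg_inj, sq_eq_sq₀ (gaussFactor_pos ha _).le (gaussFactor_pos ha _).le] at h
  simp only [gaussFactor, inv_inj] at h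
  simp [ha.ne'] at h
  rcases h with h | h <;> linarith

/-! ### Conformality of the Gauss map and its action on loxodromes. -/

theorem fderiv_normal_of_mem {p v : E3} (hp : p ∈ (catenoid a ha).carrier)
    (hv : v ∈ (catenoid a ha).tangentPlane p) :
    fderiv ℝ (catenoid a ha).normal p v =
      gaussFactor a p • (inner ℝ ((catenoid a ha).meridianDir p) v • (catenoid a ha).meridianDir p
        - inner ℝ (parallelDir p) v • parallelDir p) := by
  conv_lhs => rw [← isSurfaceOfRevolution_catenoid.isFrame.expansion hp hv]
  rw [map_add, map_smul, map_smul, fderiv_normal_meridianDir hp, fderiv_normal_parallelDir hp]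
  module

/-- On the tangent plane `dN` is `k` times the reflection fixing `e₁` and reversing `e₂`. -/
theorem inner_fderiv_normal {p v w : E3} (hp : p ∈ (catenoid a ha).carrier)
    (hv : v ∈ (catenoid a ha).tangentPlane p) (hw : w ∈ (catenoid a ha).tangentPlane p) :
    inner ℝ (fderiv ℝ (catenoid a ha).normal p v) (fderiv ℝ (catenoid a ha).normal p w) =
      gaussFactor a p ^ 2 * inner ℝ v w := by
  have hf := (isSurfaceOfRevolution_catenoid (ha := ha)).isFrame
  have h12 := hf.inner_eq_zero p hp
  rw [fderiv_normal_of_mem hp hv, fderiv_normal_of_mem hp hw, hf.inner_eq hp hv]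
  simp only [inner_smul_left, inner_smul_right, inner_sub_left, inner_sub_right,
    real_inner_self_eq_norm_sq, hf.norm_fst p hp, hf.norm_snd p hp, h12,
    real_inner_comm ((catenoid a ha).meridianDir p) (parallelDir p), conj_trivial]
  ring

theorem axisDist_normal {p : E3} (hp : p ∈ (catenoid a ha).carrier) :
    axisDist ((catenoid a ha).normal p) = (Real.cosh (p 2 / a))⁻¹ := by
  have hC := Real.cosh_pos (p 2 / a)
  have hp' := mem_catenoid.1 hp
  rw [axisDist, Real.sqrt_eq_iff_mul_self_eq (by positivity) (by positivity), catenoid_normal]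
  simp
  field_simp
  linarith

theorem mapsTo_normal : MapsTo (catenoid a ha).normal (catenoid a ha).carrier
    puncturedSphere.carrier := by
  intro p hp
  rw [mem_puncturedSphere, axisDist_normal hp]
  refine ⟨?_, inv_pos.2 (Real.cosh_pos _)⟩
  have h := OrientedSurface.inner_normal_self hp
  rw [inner_eq_coord] at h
  linarith

theorem isConformalMap_normal :
    (catenoid a ha).IsConformalMap puncturedSphere (catenoid a ha).normal :=
  ⟨(catenoid a ha).normal_smooth, mapsTo_normal, fun p hp =>
    ⟨gaussFactor a p ^ 2, pow_pos (gaussFactor_pos ha p) 2, fun _ hv _ hw =>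
      inner_fderiv_normal hp hv hw⟩⟩

/-- The normal points towards the axis, so `N p` lies on the opposite side of the axis from `p`. -/
theorem parallelDir_normal {p : E3} (hp : p ∈ (catenoid a ha).carrier) :
    parallelDir ((catenoid a ha).normal p) = -parallelDir p := by
  have hC := Real.cosh_pos (p 2 / a)
  rw [parallelDir_of_mem_catenoid hp, parallelDir, axisDist_normal hp, catenoid_normal]
  ext i
  fin_cases i
  · simp
    field_simp
  · simp
    field_simp
  · simp

/-- The sphere at `N p` and the catenoid at `p` have the same normal, so `e₁ = e₂ × N` changes sign
with `e₂`. -/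
theorem meridianDir_normal {p : E3} (hp : p ∈ (catenoid a ha).carrier) :
    puncturedSphere.meridianDir ((catenoid a ha).normal p) = -(catenoid a ha).meridianDir p := by
  have h : puncturedSphere.normal ((catenoid a ha).normal p) = (catenoid a ha).normal p := rfl
  rw [OrientedSurface.meridianDir, OrientedSurface.meridianDir, h, parallelDir_normal hp,
    WithLp.ofLp_neg, map_neg, LinearMap.neg_apply, WithLp.toLp_neg]

/-- The reflection in `dN` preserves the angle with `e₁`; the meridian direction of the sphere is
`-e₁`, whence `π - α`. -/
theorem isLoxodrome_normal_comp {J : Set ℝ} {γ : ℝ → E3} (h : (catenoid a ha).IsLoxodrome J γ) :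
    puncturedSphere.IsLoxodrome J ((catenoid a ha).normal ∘ γ) := by
  obtain ⟨hreg, α, hα⟩ := h
  have hf := (isSurfaceOfRevolution_catenoid (ha := ha)).isFrame
  have hd : ∀ t ∈ J, deriv ((catenoid a ha).normal ∘ γ) t =
      fderiv ℝ (catenoid a ha).normal (γ t) (deriv γ t) := fun t ht =>
    ((differentiable_catenoid_normal (γ t)).hasFDerivAt.comp_hasDerivAt t
      (hreg.hasDerivAt ht)).deriv
  have hnorm : ∀ t ∈ J, ‖deriv ((catenoid a ha).normal ∘ γ) t‖ =
      gaussFactor a (γ t) * ‖deriv γ t‖ := by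
    intro t ht
    have hp := (hreg.2.2.2.2 t ht).1
    have hv := hreg.deriv_mem ht
    have := gaussFactor_pos ha (γ t)
    rw [hd t ht, ← sq_eq_sq₀ (norm_nonneg _) (by positivity), ← real_inner_self_eq_norm_sq,
      inner_fderiv_normal hp hv hv, real_inner_self_eq_norm_sq]
    ring
  refine ⟨⟨hreg.1, hreg.2.1, hreg.2.2.1, contDiff_catenoid_normal.comp_contDiffOn hreg.2.2.2.1,
    fun t ht => ⟨mapsTo_normal (hreg.2.2.2.2 t ht).1, ?_⟩⟩, Real.pi - α, fun t ht => ?_⟩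
  · rw [← norm_ne_zero_iff, hnorm t ht]
    exact mul_ne_zero (gaussFactor_pos ha _).ne' (norm_ne_zero_iff.2 (hreg.2.2.2.2 t ht).2)
  · have hp := (hreg.2.2.2.2 t ht).1
    have hv := hreg.deriv_mem ht
    have hk := gaussFactor_pos ha (γ t)
    rw [Function.comp_apply, meridianDir_normal hp, InnerProductGeometry.angle_neg_right,
      ← hα t ht, InnerProductGeometry.angle, InnerProductGeometry.angle, hnorm t ht, hd t ht,
      fderiv_normal_of_mem hp hv, inner_smul_left, inner_sub_left, inner_smul_left,
      inner_smul_left, real_inner_comm ((catenoid a ha).meridianDir (γ t)) (parallelDir (γ t)),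
      hf.inner_eq_zero _ hp, real_inner_self_eq_norm_sq, hf.norm_fst _ hp,
      real_inner_comm (deriv γ t)]
    congr 2
    simp only [conj_trivial]
    field_simp
    ring_nf

/-- The inverse of the Gauss map of the catenoid. -/
def gaussMapInverse (a : ℝ) (q : E3) : E3 :=
  !₂[-a * q 0 / (q 0 ^ 2 + q 1 ^ 2), -a * q 1 / (q 0 ^ 2 + q 1 ^ 2),
    a * (1 / 2 * Real.log ((1 + q 2) / (1 - q 2)))]

theorem mem_Ioo_of_mem_puncturedSphere {q : E3} (hq : q ∈ puncturedSphere.carrier) :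
    q 2 ∈ Ioo (-1 : ℝ) 1 := by
  have h1 := hq.1
  have h2 : 0 < axisDist q ^ 2 := pow_pos hq.2 2
  rw [axisDist_sq] at h2
  rw [mem_Ioo, ← abs_lt, ← sq_lt_one_iff_abs_lt_one]
  linarith

theorem smoothNear_gaussMapInverse : SmoothNear puncturedSphere.carrier (gaussMapInverse a) := by
  have hc := fun i => contDiff_coord i
  have ho : IsOpen {q : E3 | q 2 ∈ Ioo (-1 : ℝ) 1} := isOpen_Ioo.preimage (hc 2).continuous
  refine ⟨_, isOpen_axisDist_pos.inter ho, fun q hq => ⟨hq.2, mem_Ioo_of_mem_puncturedSphere hq⟩,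
    ?_⟩
  have hne : ∀ q ∈ {q : E3 | 0 < axisDist q} ∩ {q : E3 | q 2 ∈ Ioo (-1 : ℝ) 1},
      q 0 ^ 2 + q 1 ^ 2 ≠ 0 := fun q hq => by
    rw [← axisDist_sq]
    exact pow_ne_zero 2 (ne_of_gt hq.1)
  have hr := (((hc 0).pow 2).add ((hc 1).pow 2)).contDiffOn
    (s := {q : E3 | 0 < axisDist q} ∩ {q : E3 | q 2 ∈ Ioo (-1 : ℝ) 1})
  rw [contDiffOn_euclidean]
  intro i
  fin_cases i
  · exact (contDiff_const.mul (hc 0)).contDiffOn.div hr hne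
  · exact (contDiff_const.mul (hc 1)).contDiffOn.div hr hne
  · refine contDiffOn_const.mul (contDiffOn_const.mul (ContDiffOn.log
      ((contDiff_const.add (hc 2)).contDiffOn.div (contDiff_const.sub (hc 2)).contDiffOn ?_) ?_))
    · rintro q ⟨-, -, h⟩
      exact (sub_pos.2 h).ne'
    · rintro q ⟨-, h', h⟩
      exact (div_pos (neg_lt_iff_pos_add'.1 h') (sub_pos.2 h)).ne'

/-- The third coordinate of `N` is `tanh (z/a)`, inverted by `artanh`. The logarithmic form serves
smoothness, this one the inversion. -/
theorem gaussMapInverse_apply_two {q : E3} (hq : q 2 ∈ Ioo (-1 : ℝ) 1) :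
    gaussMapInverse a q 2 = a * Real.artanh (q 2) := by
  rw [Real.artanh_eq_half_log (Ioo_subset_Icc_self hq)]
  rfl

theorem cosh_artanh_sq {q : E3} (hq : q ∈ puncturedSphere.carrier) :
    Real.cosh (Real.artanh (q 2)) ^ 2 = (q 0 ^ 2 + q 1 ^ 2)⁻¹ := by
  have h1 : q 0 ^ 2 + q 1 ^ 2 = 1 - q 2 ^ 2 := by linarith [hq.1]
  rw [Real.cosh_artanh (mem_Ioo_of_mem_puncturedSphere hq), ← h1, div_pow,
    Real.sq_sqrt (by positivity), one_pow, one_div]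

theorem mapsTo_gaussMapInverse : MapsTo (gaussMapInverse a) puncturedSphere.carrier
    (catenoid a ha).carrier := by
  intro q hq
  have hρ : 0 < q 0 ^ 2 + q 1 ^ 2 := by
    rw [← axisDist_sq]
    exact pow_pos hq.2 2
  rw [mem_catenoid, gaussMapInverse_apply_two (mem_Ioo_of_mem_puncturedSphere hq),
    mul_div_cancel_left₀ _ ha.ne', cosh_artanh_sq hq]
  simp [gaussMapInverse]
  field_simp

theorem invOn_gaussMapInverse : InvOn (gaussMapInverse a) (catenoid a ha).normal
    (catenoid a ha).carrier puncturedSphere.carrier := by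
  constructor
  · intro p hp
    have hC := Real.cosh_pos (p 2 / a)
    have hN := mapsTo_normal hp
    have h2 := axisDist_sq ((catenoid a ha).normal p)
    rw [axisDist_normal hp] at h2
    have ht : (catenoid a ha).normal p 2 = Real.tanh (p 2 / a) :=
      (Real.tanh_eq_sinh_div_cosh _).symm
    ext i
    fin_cases i
    · have : gaussMapInverse a ((catenoid a ha).normal p) 0 = -a * (catenoid a ha).normal p 0 /
        ((catenoid a ha).normal p 0 ^ 2 + (catenoid a ha).normal p 1 ^ 2) := rfl
      simp only [Fin.zero_eta]
      rw [this, ← h2, catenoid_normal]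
      simp
      field_simp
    · have : gaussMapInverse a ((catenoid a ha).normal p) 1 = -a * (catenoid a ha).normal p 1 /
        ((catenoid a ha).normal p 0 ^ 2 + (catenoid a ha).normal p 1 ^ 2) := rfl
      simp only [Fin.mk_one]
      rw [this, ← h2, catenoid_normal]
      simp
      field_simp
    · simp only [Fin.reduceFinMk]
      rw [gaussMapInverse_apply_two (mem_Ioo_of_mem_puncturedSphere hN), ht, Real.artanh_tanh,
        mul_div_cancel₀ _ ha.ne']
  · intro q hq
    have hI := mem_Ioo_of_mem_puncturedSphere hq
    have hρ : 0 < q 0 ^ 2 + q 1 ^ 2 := by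
      rw [← axisDist_sq]
      exact pow_pos hq.2 2
    have hz : gaussMapInverse a q 2 / a = Real.artanh (q 2) := by
      rw [gaussMapInverse_apply_two hI, mul_div_cancel_left₀ _ ha.ne']
    rw [catenoid_normal, hz, cosh_artanh_sq hq, ← Real.tanh_eq_sinh_div_cosh,
      Real.tanh_artanh hI]
    ext i
    fin_cases i
    · simp [gaussMapInverse]
      field_simp
    · simp [gaussMapInverse]
      field_simp
    · simp

theorem isDiffeo_normal : (catenoid a ha).IsDiffeo puncturedSphere (catenoid a ha).normal :=
  ⟨gaussMapInverse a, (catenoid a ha).normal_smooth, smoothNear_gaussMapInverse, mapsTo_normal,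
    mapsTo_gaussMapInverse, invOn_gaussMapInverse⟩

theorem isGeodesicMapping_normal : (catenoid a ha).IsGeodesicMapping
    (catenoid a ha).revolutionField puncturedSphere puncturedSphere.revolutionField
    (catenoid a ha).normal :=
  ⟨isDiffeo_normal, fun _ _ hγ => isSurfaceOfRevolution_puncturedSphere.isLoxodrome_iff.1
    (isLoxodrome_normal_comp (isSurfaceOfRevolution_catenoid.isGeodesic_iff.1 hγ).1)⟩

/-! ### Connectedness and the counterexample. -/

theorem isConnected_catenoid : IsConnected (catenoid a ha).carrier := by
  have hr : (catenoid a ha).carrier = range fun x : ℝ × ℝ => (!₂[a * Real.cosh (x.2 / a) *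
      Real.cos x.1, a * Real.cosh (x.2 / a) * Real.sin x.1, x.2] : E3) := by
    ext p
    constructor
    · intro hp
      have hC := Real.cosh_pos (p 2 / a)
      have hp' := mem_catenoid.1 hp
      -- The polar angle of a point is the argument of `x + i y`.
      have hn : ‖(⟨p 0, p 1⟩ : ℂ)‖ = a * Real.cosh (p 2 / a) := by
        rw [← axisDist_of_mem_catenoid hp, Complex.norm_eq_sqrt_sq_add_sq, axisDist]
      refine ⟨(Complex.arg ⟨p 0, p 1⟩, p 2), ?_⟩
      simp only [← hn, Complex.norm_mul_cos_arg, Complex.norm_mul_sin_arg]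
      ext i
      fin_cases i <;> rfl
    · rintro ⟨x, rfl⟩
      have := Real.sin_sq_add_cos_sq x.1
      rw [mem_catenoid]
      simp
      linear_combination a ^ 2 * Real.cosh (x.2 / a) ^ 2 * this
  rw [hr]
  refine isConnected_range ?_
  refine (PiLp.continuous_toLp 2 _).comp (continuous_pi fun i => ?_)
  fin_cases i <;> simp <;> fun_prop

/-- The Gauss map carries connectedness over from the catenoid. -/
theorem isConnected_puncturedSphere : IsConnected puncturedSphere.carrier := by
  have h : (catenoid 1 one_pos).normal '' (catenoid 1 one_pos).carrier = puncturedSphere.carrier :=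
    (invOn_gaussMapInverse.bijOn mapsTo_normal mapsTo_gaussMapInverse).image_eq
  rw [← h]
  exact isConnected_catenoid.image _ contDiff_catenoid_normal.continuous.continuousOn

end Catenoid

theorem not_beltramiAssertion : ¬ BeltramiAssertion := fun h =>
  not_hasConstantCurvature_catenoid <|
    h (catenoid 1 one_pos) puncturedSphere _ _ _ isConnected_catenoid isConnected_puncturedSphere
      isSurfaceOfRevolution_catenoid.isTangentField_revolutionField
      isSurfaceOfRevolution_puncturedSphere.isTangentField_revolutionField
      isGeodesicMapping_normal ⟨1, fun _ hp => gaussianCurvature_puncturedSphere hp⟩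

end

end VectorialTorsion

theorem mainTheorem3 :
    -- on surfaces of revolution, loxodromes are the geodesics of the flat connection
    (∀ S : OrientedSurface, S.IsSurfaceOfRevolution →
      S.IsTangentField S.revolutionField ∧
      S.IsParallel S.revolutionField S.meridianDir ∧
      S.IsParallel S.revolutionField parallelDir ∧
      S.IsFlat S.revolutionField ∧
      (∀ (J : Set ℝ) (γ : ℝ → E3), S.IsGeodesic S.revolutionField J γ ↔
        S.IsLoxodrome J γ ∧ ∃ E : ℝ, ∀ t ∈ J, ‖deriv γ t‖ = E) ∧
      (∀ (J : Set ℝ) (γ : ℝ → E3),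
        S.IsLoxodrome J γ ↔ S.IsGeodesicUpToParam S.revolutionField J γ)) ∧
    -- the catenoid and its Gauss map
    (∀ (a : ℝ) (ha : 0 < a),
      (catenoid a ha).IsSurfaceOfRevolution ∧
      puncturedSphere.IsSurfaceOfRevolution ∧
      (catenoid a ha).IsMinimal ∧
      (catenoid a ha).IsConformalMap puncturedSphere (catenoid a ha).normal ∧
      (∀ (J : Set ℝ) (γ : ℝ → E3), (catenoid a ha).IsLoxodrome J γ →
        puncturedSphere.IsLoxodrome J ((catenoid a ha).normal ∘ γ)) ∧
      (catenoid a ha).IsGeodesicMapping (catenoid a ha).revolutionField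
        puncturedSphere puncturedSphere.revolutionField (catenoid a ha).normal ∧
      (∀ p ∈ puncturedSphere.carrier, puncturedSphere.gaussianCurvature p = 1) ∧
      ¬ (catenoid a ha).HasConstantCurvature) ∧
    -- the assertion of Beltrami's theorem fails for connections with vectorial torsion
    ¬ BeltramiAssertion := by
  exact ⟨fun S h => ⟨h.isTangentField_revolutionField, h.isParallel_meridianDir,
      h.isParallel_parallelDir, h.isFlat_revolutionField, fun _ _ => h.isGeodesic_iff,
      fun _ _ => h.isLoxodrome_iff⟩,
    fun _ _ => ⟨isSurfaceOfRevolution_catenoid, isSurfaceOfRevolution_puncturedSphere,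
      isMinimal_catenoid, isConformalMap_normal, fun _ _ => isLoxodrome_normal_comp,
      isGeodesicMapping_normal, fun _ => gaussianCurvature_puncturedSphere,
      not_hasConstantCurvature_catenoid⟩,
    not_beltramiAssertion⟩
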